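/- **Conventions.** $\mathrm{Fin}(\omega_1)$ is the set of nonempty finite subsets of $\omega_1$. For sets of ordinals, $A\sqsubseteq B$ means that $A$ is an initial segment of $B$, and $A<B$ means that every element of $A$ is below every element of $B$. For a finite set $D$ of ordinals, $D(a)$ is its $a$-th element in increasing order. A *type* is a sequence $\tau=\langle m_k,n_{k+1},r_{k+1}\rangle_{k\in\omega}$ of natural numbers with $m_0=1$, $n_{k+1}\ge 2$, $r_{k+1}<m_k$ and $m_{k+1}=r_{k+1}+(m_k-r_{k+1})n_{k+1}$; it is *good* if for each $r\in\omega$ there are infinitely many $k$ with $r_k=r$. **Construction schemes.** A *construction scheme* of type $\tau$ over $\omega_1$ is a family $\mathcal F\subseteq \mathrm{Fin}(\omega_1)$ which is cofinal in $(\mathrm{Fin}(\omega_1),\subseteq)$, each of whose members has size $m_k$ for some $k$, and such that, with $\mathcal F_k=\{F\in\mathcal F:|F|=m_k\}$: (i) $E\cap F\sqsubseteq E,F$ for all $E,F\in\mathcal F_k$; (ii) each $F\in\mathcal F_{k+1}$ is a union $\bigcup_{i<n_{k+1}}F_i$ of members of $\mathcal F_k$ forming a $\Delta$-system with root $R(F)$,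 $|R(F)|=r_{k+1}$, and $R(F)<F_0\setminus R(F)<\dots<F_{n_{k+1}-1}\setminus R(F)$. The sets $F_i$ and $R(F)$ are determined by $F$. Put $$\rho(\alpha,\beta)=\min\{k:\exists F\in\mathcal F_k\ \{\alpha,\beta\}\subseteq F\},\quad (\alpha)_k=\{\xi\le\alpha:\rho(\alpha,\xi)\le k\},\quad \|\alpha\|_k=|(\alpha)_k\setminus\{\alpha\}|,$$ and let $\Delta(\alpha,\beta)$ be the least $k$ with $\|\alpha\|_k\ne\|\beta\|_k$ ($\omega$ if there is none). Let $\Xi_\alpha(0)=0$ and, for $k\ge1$ and any $F\in\mathcal F_k$ containing $\alpha$, let $\Xi_\alpha(k)=-1$ if $\alpha\in R(F)$ and $\Xi_\alpha(k)=i$ if $\alpha\in F_i\setminus R(F)$ (this does not depend on $F$). **Capturing.** Let $\langle D_i\rangle_{i<n}$ be distinct subsets of $\omega_1$ of a common finite size $m\ge1$ forming a $\Delta$-system with root $R$, $|R|=r$, such that $R<D_i\setminus R$ for each $i$ and, for $i\neq j$, one of $D_i\setminus R<D_j\setminus R$ and $D_j\setminus R<D_i\setminus R$ holds. It is *captured at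 level $l$* if $\Xi_{D_i(a)}(l)=-1$ for $a<r$, $\Xi_{D_i(a)}(l)=i$ for $r\le a<m$, and $\rho(D_i(a),D_j(a))=l=\Delta(D_i(a),D_j(a))$ for $i<j<n$ and $r\le a<m$. A pair $\{\alpha,\beta\}$ with $\alpha<\beta$ is *captured* if $\langle\{\alpha\},\{\beta\}\rangle$ is captured at some level. $\mathcal F$ is *$n$-capturing* if for each uncountable $\mathcal S\subseteq\mathrm{Fin}(\omega_1)$ there are infinitely many $l$ for which some $n$ elements of $\mathcal S$, suitably enumerated, are captured at level $l$. **Martin's numbers.** For a forcing notion $\mathbb P$ (a preorder with a largest element), $\mathfrak m(\mathbb P)$ is the least size of a family of dense subsets of $\mathbb P$ not all met by a single filter ($\infty$ if there is no such family). If $\mathcal F$ is $2$-capturing, $\mathfrak m_{\mathcal F}$ is the minimum of $\mathfrak m(\mathbb P)$ over all ccc forcing notions $\mathbb P$ with $\mathbb P\Vdash$ "$\mathcal F$ is $2$-capturing"; otherwise $\mathfrak m_{\mathcal F}=\omega$. **The square-bracket filter.** For $\alpha<\beta<\omega_1$ let $[\![\alpha,\beta]\!]=\min\{\xi\in(\beta)_{\rho(\alpha,\beta)-1}:\xi\ge\alpha\}$,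 and for $S\subseteq\omega_1$ let $(\!|S|\!)=\{[\![\alpha,\beta]\!]:\alpha<\beta,\ \alpha,\beta\in S,\ \{\alpha,\beta\}\text{ is captured}\}$. Let $\mathcal V(\mathcal F)$ be the set of all $A\subseteq\omega_1$ for which there is an uncountable $S\subseteq\omega_1$ with $(\!|S|\!)\subseteq A$. For $\pi:\omega_1\to\omega$ put $\pi\mathcal V(\mathcal F)=\{A\subseteq\omega:\pi^{-1}[A]\in\mathcal V(\mathcal F)\}$. A nonprincipal ultrafilter $\mathcal U$ on $\omega$ is *Ramsey* if for every infinite partition $\mathcal P$ of $\omega$ into sets whose complements are in $\mathcal U$ there is $A\in\mathcal U$ with $|A\cap P|\le1$ for all $P\in\mathcal P$. **Theorem.** Let $\mathcal F$ be a $2$-capturing construction scheme over $\omega_1$ of good type with $\mathfrak m_{\mathcal F}>\omega_1$. Then: 1. $\mathcal V(\mathcal F)$ is a uniform ultrafilter on $\omega_1$ (an ultrafilter all of whose members are uncountable). 2. There is a surjection $\pi:\omega_1\to\omega$ with $\pi^{-1}[\{k\}]\notin\mathcal V(\mathcal F)$ for every $k\in\omega$. 3. For every $\pi:\omega_1\to\omega$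 with $\pi^{-1}[\{k\}]\notin\mathcal V(\mathcal F)$ for every $k\in\omega$, the family $\pi\mathcal V(\mathcal F)$ is a (nonprincipal) Ramsey ultrafilter on $\omega$. -/

import Mathlib

noncomputable section

namespace ConstructionSchemes

/-- The ordinal `ω₁`, as a well-ordered type. -/
abbrev Omega1 : Type := (Ordinal.omega.{0} 1).ToType

/-- `Fin(ω₁)`: the nonempty finite subsets of `ω₁`. -/
abbrev FinSets : Type := {A : Finset Omega1 // A.Nonempty}

/-! ### Types and construction schemes -/

/-- A type `⟨m_k, n_{k+1}, r_{k+1}⟩_{k ∈ ω}`. The values `n 0` and `r 0` are never used. -/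
structure SchemeType where
  m : ℕ → ℕ
  n : ℕ → ℕ
  r : ℕ → ℕ
  m_zero : m 0 = 1
  two_le_n : ∀ k, 2 ≤ n (k + 1)
  r_lt_m : ∀ k, r (k + 1) < m k
  m_succ : ∀ k, m (k + 1) = r (k + 1) + (m k - r (k + 1)) * n (k + 1)

/-- A type is good if every natural number is equal to `r_k` for infinitely many `k`. -/
def SchemeType.Good (τ : SchemeType) : Prop :=
  ∀ s : ℕ, {k : ℕ | 1 ≤ k ∧ τ.r k = s}.Infinite

/-- `A ⊑ B`: `A` is an initial segment of `B`. -/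
def IsInitialSegment (A B : Finset Omega1) : Prop :=
  A ⊆ B ∧ ∀ x ∈ B, ∀ y ∈ A, x < y → x ∈ A

/-- `A < B`: every element of `A` is below every element of `B`. -/
def Below (A B : Finset Omega1) : Prop :=
  ∀ x ∈ A, ∀ y ∈ B, x < y

/-- `F` is the union of the sets `D i` (`i < N`), which form a Δ-system with root `R` such that
`R < D 0 \ R < ... < D (N - 1) \ R`. -/
structure IsDecomposition (F R : Finset Omega1) {N : ℕ} (D : Fin N → Finset Omega1) : Prop where
  union : ∀ x, x ∈ F ↔ ∃ i, x ∈ D i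
  root : ∀ i j, i ≠ j → D i ∩ D j = R
  root_below : ∀ i, Below R (D i \ R)
  tails : ∀ i j, i < j → Below (D i \ R) (D j \ R)

/-- A construction scheme of type `τ` over `ω₁`. -/
structure ConstructionScheme (τ : SchemeType) where
  carrier : Set (Finset Omega1)
  cofinal : ∀ A : Finset Omega1, A.Nonempty → ∃ F ∈ carrier, A ⊆ F
  card_mem : ∀ F ∈ carrier, ∃ k, F.card = τ.m k
  inter_initial : ∀ k, ∀ F ∈ carrier, ∀ E ∈ carrier, F.card = τ.m k → E.card = τ.m k →
    IsInitialSegment (E ∩ F) E ∧ IsInitialSegment (E ∩ F) F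
  decomposition : ∀ k, ∀ F ∈ carrier, F.card = τ.m (k + 1) →
    ∃ (R : Finset Omega1) (D : Fin (τ.n (k + 1)) → Finset Omega1),
      (∀ i, D i ∈ carrier ∧ (D i).card = τ.m k) ∧
      R.card = τ.r (k + 1) ∧ IsDecomposition F R D

namespace ConstructionScheme

variable {τ : SchemeType} (𝓕 : ConstructionScheme τ)

/-- `𝓕_k`, the members of `𝓕` of cardinality `m_k`. -/
def level (k : ℕ) : Set (Finset Omega1) :=
  {F | F ∈ 𝓕.carrier ∧ F.card = τ.m k}

/-- `R` and `D` are the root and the canonical decomposition of `F ∈ 𝓕_{k+1}`. -/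
def IsCanonical (k : ℕ) (F R : Finset Omega1) (D : Fin (τ.n (k + 1)) → Finset Omega1) : Prop :=
  (∀ i, D i ∈ 𝓕.level k) ∧ R.card = τ.r (k + 1) ∧ IsDecomposition F R D

/-- `ρ(α, β)`, the least `k` such that some `F ∈ 𝓕_k` contains both `α` and `β`. -/
def rho (α β : Omega1) : ℕ :=
  sInf {k | ∃ F ∈ 𝓕.level k, α ∈ F ∧ β ∈ F}

/-- The `k`-closure `(α)_k = {ξ ≤ α : ρ(α, ξ) ≤ k}`. -/
def closure (α : Omega1) (k : ℕ) : Set Omega1 :=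
  {ξ | ξ ≤ α ∧ 𝓕.rho α ξ ≤ k}

/-- The `k`-cardinality `‖α‖_k`, the number of elements of `(α)_k \ {α}`. -/
def kcard (α : Omega1) (k : ℕ) : ℕ :=
  (𝓕.closure α k \ {α}).ncard

/-- `Δ(α, β)`, the least `k` with `‖α‖_k ≠ ‖β‖_k`, and `ω` (that is `⊤`) if there is none. -/
def delta (α β : Omega1) : ℕ∞ :=
  ⨅ (k : ℕ) (_ : 𝓕.kcard α k ≠ 𝓕.kcard β k), (k : ℕ∞)

/-- `IsXi α k i` says that, for some `F ∈ 𝓕_{k+1}` with `α ∈ F`, either `α` lies in the root of `F`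
and `i = -1`, or `α` lies in the `i`-th piece of `F` and outside the root. -/
def IsXi (α : Omega1) (k : ℕ) (i : ℤ) : Prop :=
  ∃ F ∈ 𝓕.level (k + 1), α ∈ F ∧ ∃ R D, 𝓕.IsCanonical k F R D ∧
    ((α ∈ R ∧ i = -1) ∨ ∃ j : Fin (τ.n (k + 1)), α ∈ D j \ R ∧ i = (j : ℕ))

/-- The function `Ξ_α : ω → {-1} ∪ ω`. The number `i` with `IsXi α k i` exists and is unique. -/
def Xi (α : Omega1) : ℕ → ℤ
  | 0 => 0
  | k + 1 => Classical.epsilon fun i : ℤ => 𝓕.IsXi α k i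

/-- The system `⟨D_i⟩_{i < n}` of distinct sets of a common size `m ≥ 1` is a root-tail-tail
Δ-system, with a root `R` of size `r`, which is captured at level `l`. Here `D_i(a)` is the `a`-th
element of `D_i` in increasing order. -/
def Captured {n : ℕ} (D : Fin n → Finset Omega1) (l : ℕ) : Prop :=
  Function.Injective D ∧
  ∃ (m : ℕ) (hD : ∀ i, (D i).card = m) (R : Finset Omega1),
    1 ≤ m ∧
    (∀ i, R ⊆ D i) ∧ (∀ i j, i ≠ j → D i ∩ D j = R) ∧
    (∀ i, Below R (D i \ R)) ∧
    (∀ i j, i ≠ j → Below (D i \ R) (D j \ R) ∨ Below (D j \ R) (D i \ R)) ∧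
    (∀ (i : Fin n) (a : Fin m), 𝓕.Xi ((D i).orderEmbOfFin (hD i) a) l =
      if (a : ℕ) < R.card then -1 else ((i : ℕ) : ℤ)) ∧
    (∀ i j : Fin n, i < j → ∀ a : Fin m, R.card ≤ (a : ℕ) →
      𝓕.rho ((D i).orderEmbOfFin (hD i) a) ((D j).orderEmbOfFin (hD j) a) = l ∧
      𝓕.delta ((D i).orderEmbOfFin (hD i) a) ((D j).orderEmbOfFin (hD j) a) = (l : ℕ∞))

/-- `𝓕` is `n`-capturing: every uncountable `S ⊆ Fin(ω₁)` contains, for infinitely many `l`, a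
system of `n` sets which is captured at level `l`. -/
def IsCapturing (n : ℕ) : Prop :=
  ∀ S : Set FinSets, ¬ S.Countable →
    {l : ℕ | ∃ D : Fin n → FinSets,
      (∀ i, D i ∈ S) ∧ 𝓕.Captured (fun i => (D i : Finset Omega1)) l}.Infinite

end ConstructionScheme

/-! ### Forcing

A forcing notion is a preorder `P` with a largest element, where `q ≤ p` means that `q` is stronger
than `p`. -/

section Forcing

variable (P : Type) [Preorder P]

/-- The countable chain condition: every set of pairwise incompatible conditions is countable. -/
def CCC : Prop :=
  ∀ A : Set P, (∀ p ∈ A, ∀ q ∈ A, p ≠ q → ¬ ∃ s, s ≤ p ∧ s ≤ q) → A.Countable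

/-- `E` is dense in `P`. -/
def IsDenseSet {P : Type} [Preorder P] (E : Set P) : Prop :=
  ∀ p, ∃ q ∈ E, q ≤ p

/-- The Martin number `𝔪(P)`: the least size of a family of dense sets of `P` which are not all met
by a single filter (`⊤` if there is no such family). -/
def martinNumber : WithTop Cardinal.{0} :=
  ⨅ (𝓔 : Set (Set P)) (_ : (∀ E ∈ 𝓔, IsDenseSet E) ∧
      ¬ ∃ G : Order.PFilter P, ∀ E ∈ 𝓔, ∃ p ∈ E, p ∈ G),
    ((Cardinal.mk 𝓔 : Cardinal.{0}) : WithTop Cardinal.{0})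

/-- A (nice) `P`-name for a subset of the ground model set `X`: it attaches to `x : X` a set of
conditions, and the name is evaluated by a generic filter `G` as the set of all `x` whose attached
set meets `G`. Every subset of `X` in a generic extension is the value of such a name. -/
abbrev Name (X : Type) : Type := X → Set P

/-- A statement of the forcing language, represented by its forcing relation: `φ p` says `p ⊩ φ`. -/
abbrev Sentence : Type := P → Prop

variable {P}

/-- The usual recursive clauses of the forcing relation. -/
def Sentence.mem {X : Type} (x : X) (S : Name P X) : Sentence P :=
  fun p => ∀ q ≤ p, ∃ s ≤ q, ∃ t ∈ S x, s ≤ t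

/-- A statement about the ground model whose truth value does not change in the extension. -/
def Sentence.ground (a : Prop) : Sentence P := fun _ => a

def Sentence.and (φ ψ : Sentence P) : Sentence P := fun p => φ p ∧ ψ p

def Sentence.not (φ : Sentence P) : Sentence P := fun p => ∀ q ≤ p, ¬ φ q

def Sentence.imp (φ ψ : Sentence P) : Sentence P := fun p => ∀ q ≤ p, φ q → ψ q

/-- Universal quantification, over the elements of a ground model set or over names. -/
def Sentence.all {ι : Type} (φ : ι → Sentence P) : Sentence P := fun p => ∀ i, φ i p

/-- Existential quantification, over the elements of a ground model set or over names. -/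
def Sentence.ex {ι : Type} (φ : ι → Sentence P) : Sentence P :=
  fun p => ∀ q ≤ p, ∃ s ≤ q, ∃ i, φ i s

/-- The sentence "`S` is countable", that is "there is a set of pairs `f ⊆ X × ω` which is an
injective function on `S`". -/
def Sentence.countable {X : Type} (S : Name P X) : Sentence P :=
  .ex fun f : Name P (X × ℕ) =>
    .and (.all fun x : X => .imp (.mem x S) (.ex fun k : ℕ => .mem (x, k) f)) <|
    .and (.all fun x : X => .all fun j : ℕ => .all fun k : ℕ =>
      .imp (.and (.mem (x, j) f) (.mem (x, k) f)) (.ground (j = k)))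
    (.all fun x : X => .all fun y : X => .all fun k : ℕ =>
      .imp (.and (.mem (x, k) f) (.mem (y, k) f)) (.ground (x = y)))

/-- The sentence "`𝓕` is `n`-capturing". The finite subsets of `ω₁` are the same in the extension,
and so is the relation "captured at level `l`", which depends only on `𝓕`. -/
def Sentence.capturing {τ : SchemeType} (𝓕 : ConstructionScheme τ) (n : ℕ) : Sentence P :=
  .all fun S : Name P FinSets =>
    .imp (.not (.countable S)) <|
      .all fun k : ℕ => .ex fun l : ℕ => .ex fun D : Fin n → FinSets =>
        .and (.ground (k ≤ l ∧ 𝓕.Captured (fun i => (D i : Finset Omega1)) l))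
          (.all fun i : Fin n => .mem (D i) S)

/-- `P ⊩ "𝓕 is n-capturing"`. -/
def Preserves {τ : SchemeType} (P : Type) [Preorder P] [OrderTop P] (n : ℕ)
    (𝓕 : ConstructionScheme τ) : Prop :=
  Sentence.capturing 𝓕 n (⊤ : P)

end Forcing

namespace ConstructionScheme

variable {τ : SchemeType} (𝓕 : ConstructionScheme τ)

open scoped Classical in
/-- The parametrized Martin number `𝔪ⁿ_𝓕`: it is `ω` if `𝓕` is not `n`-capturing, and otherwise the
least `𝔪(P)` for a ccc forcing `P` which forces `𝓕` to be `n`-capturing. -/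
def martinNumber (n : ℕ) : WithTop Cardinal.{0} :=
  if 𝓕.IsCapturing n then
    ⨅ (P : Type) (_ : Preorder P) (_ : OrderTop P) (_ : CCC P ∧ Preserves P n 𝓕),
      ConstructionSchemes.martinNumber P
  else ((Cardinal.aleph0 : Cardinal.{0}) : WithTop Cardinal.{0})

/-! ### The square-bracket filter -/

/-- The pair `{α, β}` with `α < β` is captured, i.e. `⟨{α}, {β}⟩` is captured at some level. -/
def CapturedPair (α β : Omega1) : Prop :=
  ∃ l, 𝓕.Captured ![{α}, {β}] l

open scoped Classical in
/-- `⟦α, β⟧ = min((β)_{ρ(α, β) - 1} \ α)` for `α < β` (a set that contains `β`). -/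
def bracket (α β : Omega1) : Omega1 :=
  if h : {ξ | ξ ∈ 𝓕.closure β (𝓕.rho α β - 1) ∧ α ≤ ξ}.Nonempty then
    WellFounded.min (wellFounded_lt (α := Omega1)) _ h
  else β

/-- `⦅S⦆ = {⟦α, β⟧ : α < β in S and {α, β} is captured}`. -/
def brackets (S : Set Omega1) : Set Omega1 :=
  {δ | ∃ α ∈ S, ∃ β ∈ S, α < β ∧ 𝓕.CapturedPair α β ∧ δ = 𝓕.bracket α β}

/-- The square-bracket filter `𝓥(𝓕)`. -/
def squareBracketFilter : Set (Set Omega1) :=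
  {A | ∃ S : Set Omega1, ¬ S.Countable ∧ 𝓕.brackets S ⊆ A}

end ConstructionScheme

/-- The projection `π𝓥 = {A ⊆ ω : π⁻¹[A] ∈ 𝓥}`. -/
def projection (π : Omega1 → ℕ) (𝓥 : Set (Set Omega1)) : Set (Set ℕ) :=
  {A | π ⁻¹' A ∈ 𝓥}

/-- A nonprincipal ultrafilter `U` on `ω` is Ramsey if for every infinite partition of `ω` into sets
of the dual ideal there is a member of `U` meeting each piece in at most one point. -/
def IsRamsey (U : Ultrafilter ℕ) : Prop :=
  (∀ k : ℕ, {k} ∉ U) ∧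
  ∀ 𝓟 : Set (Set ℕ), Setoid.IsPartition 𝓟 → 𝓟.Infinite → (∀ B ∈ 𝓟, Bᶜ ∈ U) →
    ∃ A ∈ U, ∀ B ∈ 𝓟, (A ∩ B).Subsingleton

end ConstructionSchemes

end

namespace ConstructionSchemes

/-! The bracket of a captured pair depends only on the set that captures it: if `a` and `b` lie in
the tails of the first two pieces of `G ∈ 𝓕_{l+1}`, then `⟦a, b⟧` is the least element of the second
tail (`InFirstTwo.isLeast_bracket`). Capturing also passes downwards. Suppose `{a, b}` is captured
by `G`, and `x ≤ a`, `y ≤ b` occupy the same position in sets of `𝓕_k`, `k ≤ l`, containing `a` and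
`b` respectively. Then either `x = y` is in the root, or `G` captures `{x, y}` with the same bracket
(`InFirstTwo.eq_or_inFirstTwo`).

The filter property follows by attaching to each `x ∈ S` some larger `σ x ∈ T` and making the
attachment uniform: brackets of pairs of values of `σ` are then brackets of both `S` and `T`.

Maximality and the Ramsey property come from one forcing. Colour `ω₁` by `h`, and let `Q` be a
hereditary family of sets of colours satisfying `Extendible`. The conditions are finite sets whose
bracket colours form a member of `Q`. In an uncountable family of conditions of the same shape and
colour set, gluing two along a captured pair of maxima creates at most one new bracket
(`InFirstTwo.brackets_union_subset`), and `Extendible` provides a pair whose new colour is allowed.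
This yields both the ccc and the preservation of 2-capturing (`Extendible.exists_captured_union`),
so a sufficiently generic filter gives an uncountable set all of whose finite subsets have bracket
colours in `Q` (`Extendible.exists_homogeneous`).

For maximality the colouring is an indicator function and `Q` forbids colour 1; for Ramseyness `Q`
consists of the partial selectors of the partition. The map to `ω` exists because `ω₁` embeds into
`2^ω`. -/

instance : Infinite Omega1 := by
  rw [Cardinal.infinite_iff]
  simp

/-! ### Arithmetic of types -/

namespace SchemeType

variable (τ : SchemeType)

lemma m_lt_m_succ (k : ℕ) : τ.m k < τ.m (k + 1) := by
  have h1 := τ.two_le_n k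
  have h2 := τ.r_lt_m k
  rw [τ.m_succ]
  obtain ⟨d, hd⟩ := Nat.exists_eq_add_of_lt h2
  have : τ.m k - τ.r (k + 1) = d + 1 := by omega
  rw [this]
  nlinarith

lemma strictMono_m : StrictMono τ.m := strictMono_nat_of_lt_succ τ.m_lt_m_succ

/-- The index of the first piece of a canonical decomposition. -/
def fst (k : ℕ) : Fin (τ.n (k + 1)) := ⟨0, by have := τ.two_le_n k; omega⟩

/-- The index of the second piece of a canonical decomposition. -/
def snd (k : ℕ) : Fin (τ.n (k + 1)) := ⟨1, by have := τ.two_le_n k; omega⟩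

lemma fst_ne_snd (k : ℕ) : τ.fst k ≠ τ.snd k := by simp [fst, snd]

end SchemeType

namespace ConstructionScheme

variable {τ : SchemeType} {𝓕 : ConstructionScheme τ}

/-! ### Levels of a construction scheme -/

lemma exists_isCanonical {k : ℕ} {F : Finset Omega1} (hF : F ∈ 𝓕.level (k + 1)) :
    ∃ R D, 𝓕.IsCanonical k F R D := by
  obtain ⟨R, D, h1, h2, h3⟩ := 𝓕.decomposition k F hF.1 hF.2
  exact ⟨R, D, h1, h2, h3⟩

lemma exists_mem_level_subset {k l : ℕ} (hkl : k ≤ l) {F : Finset Omega1} (hF : F ∈ 𝓕.level l)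
    {x : Omega1} (hx : x ∈ F) : ∃ K ∈ 𝓕.level k, x ∈ K ∧ K ⊆ F := by
  induction l, hkl using Nat.le_induction generalizing F with
  | base => exact ⟨F, hF, hx, subset_rfl⟩
  | succ l _ ih =>
    obtain ⟨R, D, h1, -, h3⟩ := exists_isCanonical hF
    obtain ⟨i, hi⟩ := (h3.union x).1 hx
    obtain ⟨K, hK, hxK, hKD⟩ := ih (h1 i) hi
    exact ⟨K, hK, hxK, fun y hy => (h3.union y).2 ⟨i, hKD hy⟩⟩

/-- Inside `G` there is a set of level `k` through `x`, and it meets `F` in an initial segment of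
`F`. -/
lemma mem_of_le_of_mem {k l : ℕ} (hkl : k ≤ l) {F G : Finset Omega1} (hF : F ∈ 𝓕.level k)
    (hG : G ∈ 𝓕.level l) {x y : Omega1} (hxF : x ∈ F) (hxG : x ∈ G) (hyF : y ∈ F) (hyx : y ≤ x) :
    y ∈ G := by
  obtain ⟨K, hK, hxK, hKG⟩ := exists_mem_level_subset hkl hG hxG
  rcases hyx.eq_or_lt with rfl | hlt
  · exact hxG
  have := (𝓕.inter_initial k F hF.1 K hK.1 hF.2 hK.2).2.2 y hyF x (by simp [hxK, hxF]) hlt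
  exact hKG (Finset.mem_inter.1 this).1

lemma exists_level_superset {A : Finset Omega1} (hA : A.Nonempty) (l : ℕ) :
    ∃ k, l ≤ k ∧ ∃ F ∈ 𝓕.level k, A ⊆ F := by
  obtain ⟨B, hAB, hB⟩ := Infinite.exists_superset_card_eq A (max A.card (τ.m l)) (le_max_left _ _)
  obtain ⟨F, hF, hBF⟩ := 𝓕.cofinal B (hA.mono hAB)
  obtain ⟨k, hk⟩ := 𝓕.card_mem F hF
  refine ⟨k, τ.strictMono_m.le_iff_le.1 ?_, F, ⟨hF, hk⟩, hAB.trans hBF⟩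
  have := Finset.card_le_card hBF
  have := le_max_right A.card (τ.m l)
  omega

lemma nonempty_of_mem_level {k : ℕ} {F : Finset Omega1} (hF : F ∈ 𝓕.level k) : F.Nonempty := by
  rw [← Finset.card_pos, hF.2]
  exact Nat.zero_lt_of_lt (τ.r_lt_m k)

lemma exists_superset_mem_level {k l : ℕ} (hkl : k ≤ l) {F : Finset Omega1}
    (hF : F ∈ 𝓕.level k) : ∃ G ∈ 𝓕.level l, F ⊆ G := by
  have hne := nonempty_of_mem_level hF
  obtain ⟨j, hj, H, hH, hFH⟩ := exists_level_superset (𝓕 := 𝓕) hne l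
  have hmax := F.max'_mem hne
  obtain ⟨K, hK, hxK, -⟩ := exists_mem_level_subset hj hH (hFH hmax)
  exact ⟨K, hK, fun y hy => mem_of_le_of_mem hkl hF hK hmax hxK hy (F.le_max' y hy)⟩

lemma exists_mem_level (x : Omega1) (k : ℕ) : ∃ F ∈ 𝓕.level k, x ∈ F := by
  obtain ⟨j, hj, H, hH, hxH⟩ := exists_level_superset (𝓕 := 𝓕) (Finset.singleton_nonempty x) k
  obtain ⟨K, hK, hxK, -⟩ := exists_mem_level_subset hj hH (Finset.singleton_subset_iff.1 hxH)
  exact ⟨K, hK, hxK⟩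

/-! ### The functions `ρ` and `‖·‖` -/

lemma rho_le_iff {α β : Omega1} {k : ℕ} :
    𝓕.rho α β ≤ k ↔ ∃ F ∈ 𝓕.level k, α ∈ F ∧ β ∈ F := by
  constructor
  · intro h
    obtain ⟨j, -, F, hF, hsub⟩ := exists_level_superset (𝓕 := 𝓕) (Finset.insert_nonempty α {β}) 0
    -- Cofinality excludes the default value `sInf ∅ = 0`.
    have hne : {k | ∃ F ∈ 𝓕.level k, α ∈ F ∧ β ∈ F}.Nonempty :=
      ⟨j, F, hF, hsub (by simp), hsub (by simp)⟩
    obtain ⟨F, hF, h1, h2⟩ := Nat.sInf_mem hne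
    obtain ⟨G, hG, hFG⟩ := exists_superset_mem_level h hF
    exact ⟨G, hG, hFG h1, hFG h2⟩
  · exact fun h => Nat.sInf_le h

lemma closure_eq {α : Omega1} {k : ℕ} {F : Finset Omega1} (hF : F ∈ 𝓕.level k) (hα : α ∈ F) :
    𝓕.closure α k = {ξ | ξ ∈ F ∧ ξ ≤ α} := by
  ext ξ
  simp only [closure, Set.mem_ofPred_eq, rho_le_iff]
  constructor
  · rintro ⟨h, G, hG, h1, h2⟩
    exact ⟨mem_of_le_of_mem le_rfl hG hF h1 hα h2 h, h⟩
  · rintro ⟨h1, h2⟩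
    exact ⟨h2, F, hF, hα, h1⟩

/-- Thus `‖α‖_k` is the position of `α`, counted from 0, in any set of `𝓕_k` containing it. -/
lemma kcard_eq {α : Omega1} {k : ℕ} {F : Finset Omega1} (hF : F ∈ 𝓕.level k) (hα : α ∈ F) :
    𝓕.kcard α k = (F.filter (· < α)).card := by
  rw [kcard, closure_eq hF hα, ← Set.ncard_coe_finset]
  congr 1
  ext ξ
  simp only [Set.mem_sdiff, Set.mem_ofPred_eq, Set.mem_singleton_iff, Finset.coe_filter,
    lt_iff_le_and_ne, and_assoc]

lemma kcard_lt_kcard {x y : Omega1} {k : ℕ} {F : Finset Omega1} (hF : F ∈ 𝓕.level k) (hx : x ∈ F)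
    (hy : y ∈ F) (h : x < y) : 𝓕.kcard x k < 𝓕.kcard y k := by
  rw [kcard_eq hF hx, kcard_eq hF hy]
  apply Finset.card_lt_card
  rw [Finset.ssubset_iff_of_subset]
  · exact ⟨x, by simp [hx, h], by simp⟩
  · intro z hz
    simp only [Finset.mem_filter] at hz ⊢
    exact ⟨hz.1, hz.2.trans h⟩

lemma kcard_inj {x y : Omega1} {k : ℕ} {F : Finset Omega1} (hF : F ∈ 𝓕.level k) (hx : x ∈ F)
    (hy : y ∈ F) (h : 𝓕.kcard x k = 𝓕.kcard y k) : x = y := by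
  rcases lt_trichotomy x y with h' | h' | h'
  · exact absurd h (kcard_lt_kcard hF hx hy h').ne
  · exact h'
  · exact absurd h (kcard_lt_kcard hF hy hx h').ne'

lemma kcard_lt_m (x : Omega1) (k : ℕ) : 𝓕.kcard x k < τ.m k := by
  obtain ⟨F, hF, hx⟩ := exists_mem_level (𝓕 := 𝓕) x k
  rw [kcard_eq hF hx, ← hF.2]
  apply Finset.card_lt_card
  rw [Finset.ssubset_iff_of_subset (Finset.filter_subset _ _)]
  exact ⟨x, hx, by simp⟩

/-! ### Positions in a canonical decomposition -/

namespace IsCanonical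

variable {k : ℕ} {F R : Finset Omega1} {D : Fin (τ.n (k + 1)) → Finset Omega1}
  (h : 𝓕.IsCanonical k F R D)
include h

lemma root_subset (i : Fin (τ.n (k + 1))) : R ⊆ D i := by
  obtain ⟨j, hj⟩ : ∃ j, i ≠ j := by
    by_cases hi : i = τ.fst k
    · exact ⟨τ.snd k, by rw [hi]; exact τ.fst_ne_snd k⟩
    · exact ⟨τ.fst k, hi⟩
  rw [← h.2.2.root i j hj]
  exact Finset.inter_subset_left

lemma piece_subset (i : Fin (τ.n (k + 1))) : D i ⊆ F := fun x hx => (h.2.2.union x).2 ⟨i, hx⟩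

lemma mem_root {i j : Fin (τ.n (k + 1))} (hij : i ≠ j) {x : Omega1} (hi : x ∈ D i) (hj : x ∈ D j) :
    x ∈ R := by
  rw [← h.2.2.root i j hij]
  exact Finset.mem_inter.2 ⟨hi, hj⟩

lemma lt_of_mem_root {i : Fin (τ.n (k + 1))} {x y : Omega1} (hx : x ∈ R) (hy : y ∈ D i)
    (hyR : y ∉ R) : x < y := h.2.2.root_below i x hx y (by simp [hy, hyR])

/-- The root is an initial segment of the piece, of size `r (k + 1)`, so membership is read off the
position. -/
lemma mem_root_iff {i : Fin (τ.n (k + 1))} {x : Omega1} (hx : x ∈ D i) :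
    x ∈ R ↔ 𝓕.kcard x k < τ.r (k + 1) := by
  rw [kcard_eq (h.1 i) hx, ← h.2.1]
  constructor
  · intro hxR
    apply Finset.card_lt_card
    rw [Finset.ssubset_iff_of_subset]
    · exact ⟨x, hxR, by simp⟩
    · intro y hy
      simp only [Finset.mem_filter] at hy
      by_contra hyR
      exact hy.2.not_gt (h.lt_of_mem_root hxR hy.1 hyR)
  · intro hlt
    by_contra hxR
    refine hlt.not_ge (Finset.card_le_card fun y hy => ?_)
    simp only [Finset.mem_filter]
    exact ⟨h.root_subset i hy, h.lt_of_mem_root hy hx hxR⟩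

lemma kcard_succ_of_mem (hF : F ∈ 𝓕.level (k + 1)) {x : Omega1} (hx : x ∈ R) :
    𝓕.kcard x (k + 1) = 𝓕.kcard x k := by
  have hx0 := h.root_subset (τ.fst k) hx
  rw [kcard_eq hF (h.piece_subset _ hx0), kcard_eq (h.1 _) hx0]
  congr 1
  ext y
  simp only [Finset.mem_filter, and_congr_left_iff]
  refine fun hyx => ⟨fun hy => ?_, fun hy => h.piece_subset _ hy⟩
  obtain ⟨i, hi⟩ := (h.2.2.union y).1 hy
  by_contra hy0
  exact hyx.not_gt (h.lt_of_mem_root hx hi fun hyR => hy0 (h.root_subset _ hyR))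

/-- Below `x` lie the `j` earlier tails, each of size `m k - r (k + 1)`, and the part of `D j` below
`x`, which includes the root. -/
lemma kcard_succ_of_notMem (hF : F ∈ 𝓕.level (k + 1)) {j : Fin (τ.n (k + 1))} {x : Omega1}
    (hx : x ∈ D j) (hxR : x ∉ R) :
    𝓕.kcard x (k + 1) = j * (τ.m k - τ.r (k + 1)) + 𝓕.kcard x k := by
  rw [kcard_eq hF (h.piece_subset _ hx), kcard_eq (h.1 _) hx]
  have hsplit : F.filter (· < x) =
      (Finset.Iio j).biUnion (fun i => D i \ R) ∪ (D j).filter (· < x) := by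
    ext y
    simp only [Finset.mem_filter, Finset.mem_union, Finset.mem_biUnion, Finset.mem_Iio,
      Finset.mem_sdiff]
    constructor
    · rintro ⟨hyF, hyx⟩
      obtain ⟨i, hi⟩ := (h.2.2.union y).1 hyF
      by_cases hyR : y ∈ R
      · exact .inr ⟨h.root_subset _ hyR, hyx⟩
      rcases lt_trichotomy i j with hij | rfl | hij
      · exact .inl ⟨i, hij, hi, hyR⟩
      · exact .inr ⟨hi, hyx⟩
      · exact absurd (h.2.2.tails j i hij x (by simp [hx, hxR]) y (by simp [hi, hyR])) hyx.not_gt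
    · rintro (⟨i, hij, hi, hyR⟩ | ⟨hy, hyx⟩)
      · exact ⟨h.piece_subset _ hi, h.2.2.tails i j hij y (by simp [hi, hyR]) x (by simp [hx, hxR])⟩
      · exact ⟨h.piece_subset _ hy, hyx⟩
  rw [hsplit, Finset.card_union_of_disjoint, Finset.card_biUnion]
  · rw [Finset.sum_congr rfl (fun i _ => Finset.card_sdiff_of_subset (h.root_subset i)),
      Finset.sum_congr rfl (fun i _ => by rw [(h.1 i).2, h.2.1]), Finset.sum_const, Fin.card_Iio,
      smul_eq_mul]
  · intro i _ i' _ hii'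
    rw [Function.onFun, Finset.disjoint_left]
    intro y hy hy'
    simp only [Finset.mem_sdiff] at hy hy'
    exact hy.2 (h.mem_root hii' hy.1 hy'.1)
  · rw [Finset.disjoint_left]
    intro y hy hy'
    simp only [Finset.mem_biUnion, Finset.mem_Iio, Finset.mem_sdiff, Finset.mem_filter] at hy hy'
    obtain ⟨i, hij, hi, hyR⟩ := hy
    exact hyR (h.mem_root hij.ne hi hy'.1)

lemma mem_root_iff_succ (hF : F ∈ 𝓕.level (k + 1)) {x : Omega1} (hx : x ∈ F) :
    x ∈ R ↔ 𝓕.kcard x (k + 1) < τ.r (k + 1) := by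
  obtain ⟨i, hi⟩ := (h.2.2.union x).1 hx
  have h1 := h.mem_root_iff hi
  by_cases hxR : x ∈ R
  · rw [h.kcard_succ_of_mem hF hxR, h1]
  · have h2 := h.kcard_succ_of_notMem hF hi hxR
    simp only [hxR, false_iff, not_lt] at h1 ⊢
    omega

end IsCanonical

/-- Division by `q` with remainders taken in `[r, r + q)` is unique; this recovers the piece index
from a position. -/
lemma eq_of_mul_add_eq {q r i j a b : ℕ} (ha : r ≤ a) (ha' : a < r + q) (hb : r ≤ b)
    (hb' : b < r + q) (h : i * q + a = j * q + b) : i = j ∧ a = b := by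
  have : i = j := by
    rcases lt_trichotomy i j with hij | hij | hij
    · have := Nat.mul_le_mul_right q (Nat.succ_le_of_lt hij)
      rw [Nat.succ_mul] at this
      omega
    · exact hij
    · have := Nat.mul_le_mul_right q (Nat.succ_le_of_lt hij)
      rw [Nat.succ_mul] at this
      omega
  subst this
  exact ⟨rfl, by omega⟩

lemma IsCanonical.eq_of_kcard_eq {k : ℕ} {F R F' R' : Finset Omega1}
    {D D' : Fin (τ.n (k + 1)) → Finset Omega1} (h : 𝓕.IsCanonical k F R D)
    (h' : 𝓕.IsCanonical k F' R' D') (hF : F ∈ 𝓕.level (k + 1)) (hF' : F' ∈ 𝓕.level (k + 1))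
    {i j : Fin (τ.n (k + 1))} {x y : Omega1} (hx : x ∈ D i) (hxR : x ∉ R) (hy : y ∈ D' j)
    (hyR : y ∉ R') (hxy : 𝓕.kcard x (k + 1) = 𝓕.kcard y (k + 1)) :
    i = j ∧ 𝓕.kcard x k = 𝓕.kcard y k := by
  rw [h.kcard_succ_of_notMem hF hx hxR, h'.kcard_succ_of_notMem hF' hy hyR] at hxy
  have hm := τ.r_lt_m k
  have h1 := kcard_lt_m (𝓕 := 𝓕) x k
  have h2 := kcard_lt_m (𝓕 := 𝓕) y k
  rw [h.mem_root_iff hx] at hxR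
  rw [h'.mem_root_iff hy] at hyR
  obtain ⟨h3, h4⟩ := eq_of_mul_add_eq (r := τ.r (k + 1)) (by omega) (by omega) (by omega) (by omega)
    hxy
  exact ⟨Fin.ext h3, h4⟩

lemma kcard_eq_of_kcard_succ_eq {x y : Omega1} {k : ℕ}
    (hxy : 𝓕.kcard x (k + 1) = 𝓕.kcard y (k + 1)) : 𝓕.kcard x k = 𝓕.kcard y k := by
  obtain ⟨F, hF, hx⟩ := exists_mem_level (𝓕 := 𝓕) x (k + 1)
  obtain ⟨F', hF', hy⟩ := exists_mem_level (𝓕 := 𝓕) y (k + 1)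
  obtain ⟨R, D, h⟩ := exists_isCanonical hF
  obtain ⟨R', D', h'⟩ := exists_isCanonical hF'
  obtain ⟨i, hi⟩ := (h.2.2.union x).1 hx
  obtain ⟨j, hj⟩ := (h'.2.2.union y).1 hy
  have h1 := h.mem_root_iff_succ hF hx
  have h2 := h'.mem_root_iff_succ hF' hy
  by_cases hxR : x ∈ R
  · have hyR : y ∈ R' := by rw [h2, ← hxy]; exact h1.1 hxR
    rw [← h.kcard_succ_of_mem hF hxR, hxy, h'.kcard_succ_of_mem hF' hyR]
  · have hyR : y ∉ R' := by rw [h2, ← hxy]; exact fun h3 => hxR (h1.2 h3)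
    exact (h.eq_of_kcard_eq h' hF hF' hi hxR hj hyR hxy).2

lemma kcard_eq_of_le {x y : Omega1} {k l : ℕ} (hkl : k ≤ l) (hxy : 𝓕.kcard x l = 𝓕.kcard y l) :
    𝓕.kcard x k = 𝓕.kcard y k := by
  induction l, hkl using Nat.le_induction with
  | base => exact hxy
  | succ l _ ih => exact ih (kcard_eq_of_kcard_succ_eq hxy)

/-- The pieces holding `a` and `b` also hold `x` and `y`. Outside the root, `a` and `b` have the
same piece index, so `x` and `y` are shifted by the same amount. -/
lemma kcard_succ_eq_of_le {x y a b : Omega1} {k : ℕ} (hab : 𝓕.kcard a (k + 1) = 𝓕.kcard b (k + 1))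
    (hxa : x ≤ a) (hx : 𝓕.rho x a ≤ k) (hyb : y ≤ b) (hy : 𝓕.rho y b ≤ k)
    (hxy : 𝓕.kcard x k = 𝓕.kcard y k) : 𝓕.kcard x (k + 1) = 𝓕.kcard y (k + 1) := by
  obtain ⟨E, hE, hxE, haE⟩ := rho_le_iff.1 hx
  obtain ⟨E', hE', hyE, hbE⟩ := rho_le_iff.1 hy
  obtain ⟨F, hF, ha⟩ := exists_mem_level (𝓕 := 𝓕) a (k + 1)
  obtain ⟨F', hF', hb⟩ := exists_mem_level (𝓕 := 𝓕) b (k + 1)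
  obtain ⟨R, D, h⟩ := exists_isCanonical hF
  obtain ⟨R', D', h'⟩ := exists_isCanonical hF'
  obtain ⟨i, hi⟩ := (h.2.2.union a).1 ha
  obtain ⟨j, hj⟩ := (h'.2.2.union b).1 hb
  have hxi := mem_of_le_of_mem le_rfl hE (h.1 i) haE hi hxE hxa
  have hyj := mem_of_le_of_mem le_rfl hE' (h'.1 j) hbE hj hyE hyb
  have h1 := h.mem_root_iff hxi
  have h2 := h'.mem_root_iff hyj
  by_cases hxR : x ∈ R
  · have hyR : y ∈ R' := by rw [h2, ← hxy]; exact h1.1 hxR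
    rw [h.kcard_succ_of_mem hF hxR, hxy, h'.kcard_succ_of_mem hF' hyR]
  · have hyR : y ∉ R' := by rw [h2, ← hxy]; exact fun h3 => hxR (h1.2 h3)
    have haR : a ∉ R := fun haR => (h.lt_of_mem_root haR hxi hxR).not_ge hxa
    have hbR : b ∉ R' := fun hbR => (h'.lt_of_mem_root hbR hyj hyR).not_ge hyb
    obtain ⟨rfl, -⟩ := h.eq_of_kcard_eq h' hF hF' hi haR hj hbR hab
    rw [h.kcard_succ_of_notMem hF hxi hxR, h'.kcard_succ_of_notMem hF' hyj hyR, hxy]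

lemma kcard_eq_of_kcard_eq {x y a b : Omega1} {k l : ℕ} (hkl : k ≤ l)
    (hab : 𝓕.kcard a l = 𝓕.kcard b l) (hxa : x ≤ a) (hx : 𝓕.rho x a ≤ k) (hyb : y ≤ b)
    (hy : 𝓕.rho y b ≤ k) (hxy : 𝓕.kcard x k = 𝓕.kcard y k) : 𝓕.kcard x l = 𝓕.kcard y l := by
  induction l, hkl using Nat.le_induction with
  | base => exact hxy
  | succ l hkl ih =>
    exact kcard_succ_eq_of_le hab hxa (hx.trans hkl) hyb (hy.trans hkl)
      (ih (kcard_eq_of_kcard_succ_eq hab))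

lemma lt_rho_of_kcard_eq {a b : Omega1} {k : ℕ} (hab : a ≠ b) (h : 𝓕.kcard a k = 𝓕.kcard b k) :
    k < 𝓕.rho a b := by
  by_contra hk
  obtain ⟨F, hF, ha, hb⟩ := rho_le_iff.1 (not_lt.1 hk)
  exact hab (kcard_inj hF ha hb h)

/-! ### The functions `Ξ` and `Δ` -/

lemma isXi_Xi (x : Omega1) (k : ℕ) : 𝓕.IsXi x k (𝓕.Xi x (k + 1)) := by
  apply Classical.epsilon_spec
  obtain ⟨F, hF, hx⟩ := exists_mem_level (𝓕 := 𝓕) x (k + 1)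
  obtain ⟨R, D, h⟩ := exists_isCanonical hF
  obtain ⟨i, hi⟩ := (h.2.2.union x).1 hx
  by_cases hxR : x ∈ R
  · exact ⟨-1, F, hF, hx, R, D, h, .inl ⟨hxR, rfl⟩⟩
  · exact ⟨(i : ℕ), F, hF, hx, R, D, h, .inr ⟨i, by simp [hi, hxR], rfl⟩⟩

lemma IsCanonical.Xi_eq_neg_one {k : ℕ} {F R : Finset Omega1}
    {D : Fin (τ.n (k + 1)) → Finset Omega1} (h : 𝓕.IsCanonical k F R D)
    (hF : F ∈ 𝓕.level (k + 1)) {x : Omega1} (hx : x ∈ R) : 𝓕.Xi x (k + 1) = -1 := by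
  obtain ⟨F', hF', hx', R', D', h', h1 | ⟨j, hj, -⟩⟩ := 𝓕.isXi_Xi x k
  · exact h1.2
  · have hxF := h.piece_subset _ (h.root_subset (τ.fst k) hx)
    rw [h.mem_root_iff_succ hF hxF, ← h'.mem_root_iff_succ hF' hx'] at hx
    exact absurd hx (Finset.mem_sdiff.1 hj).2

/-- Root membership and piece index are functions of `‖x‖_{k+1}`, so the set picked by the choice in
`Xi` does not matter. -/
lemma IsCanonical.Xi_eq {k : ℕ} {F R : Finset Omega1}
    {D : Fin (τ.n (k + 1)) → Finset Omega1} (h : 𝓕.IsCanonical k F R D)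
    (hF : F ∈ 𝓕.level (k + 1)) {x : Omega1} {i : Fin (τ.n (k + 1))} (hx : x ∈ D i) (hxR : x ∉ R) :
    𝓕.Xi x (k + 1) = (i : ℕ) := by
  have hxF := h.piece_subset _ hx
  obtain ⟨F', hF', hx', R', D', h', h1 | ⟨j, hj, hj'⟩⟩ := 𝓕.isXi_Xi x k
  · rw [h.mem_root_iff_succ hF hxF, ← h'.mem_root_iff_succ hF' hx'] at hxR
    exact absurd h1.1 hxR
  · rw [Finset.mem_sdiff] at hj
    rw [hj', (h.eq_of_kcard_eq h' hF hF' hx hxR hj.1 hj.2 rfl).1]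

lemma delta_eq_iff {x y : Omega1} {l : ℕ} : 𝓕.delta x y = l ↔
    (∀ k < l, 𝓕.kcard x k = 𝓕.kcard y k) ∧ 𝓕.kcard x l ≠ 𝓕.kcard y l := by
  classical
  constructor
  · intro h
    have h1 : ∀ k < l, 𝓕.kcard x k = 𝓕.kcard y k := by
      intro k hk
      by_contra hne
      have : 𝓕.delta x y ≤ k := iInf₂_le k hne
      rw [h] at this
      exact hk.not_ge (by exact_mod_cast this)
    refine ⟨h1, fun heq => ?_⟩
    have : ((l + 1 : ℕ) : ℕ∞) ≤ 𝓕.delta x y := by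
      refine le_iInf₂ fun k hk => ?_
      have hk' : l + 1 ≤ k := by
        by_contra hlt
        rcases (show k ≤ l by omega).eq_or_lt with rfl | h2
        · exact hk heq
        · exact hk (h1 k h2)
      exact_mod_cast hk'
    rw [h] at this
    have : l + 1 ≤ l := by exact_mod_cast this
    omega
  · rintro ⟨h1, h2⟩
    refine le_antisymm (iInf₂_le l h2) (le_iInf₂ fun k hk => ?_)
    have : l ≤ k := by
      by_contra hlt
      exact hk (h1 k (by omega))
    exact_mod_cast this

end ConstructionScheme
end ConstructionSchemes

namespace ConstructionSchemes
namespace ConstructionScheme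

variable {τ : SchemeType} {𝓕 : ConstructionScheme τ}

/-! ### Captured pairs -/

/-- The numerical form of "`⟨{a}, {b}⟩` is captured at level `l`". -/
structure CapturedAt (𝓕 : ConstructionScheme τ) (a b : Omega1) (l : ℕ) : Prop where
  Xi_left : 𝓕.Xi a l = 0
  Xi_right : 𝓕.Xi b l = 1
  rho_eq : 𝓕.rho a b = l
  delta_eq : 𝓕.delta a b = l

lemma captured_singletons_iff {a b : Omega1} (hab : a ≠ b) {l : ℕ} :
    𝓕.Captured ![{a}, {b}] l ↔ 𝓕.CapturedAt a b l := by
  constructor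
  · rintro ⟨-, m, hD, R, hm, -, hR, -, -, h1, h2⟩
    have hR0 : R = ∅ := by
      rw [← hR 0 1 (by decide)]
      simp [hab]
    subst hR0
    have hm1 : m = 1 := by simpa using (hD 0).symm
    subst hm1
    have h3 := h2 0 1 (by decide) 0 (by simp)
    have h4 := h1 0 0
    have h5 := h1 1 0
    simp only [Finset.card_empty, not_lt_zero, if_false] at h4 h5
    have e0 : (Finset.orderEmbOfFin _ (hD 0)) 0 = a := by
      simp
    have e1 : (Finset.orderEmbOfFin _ (hD 1)) 0 = b := by
      simp
    rw [e0] at h3 h4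
    rw [e1] at h3 h5
    exact ⟨by simpa using h4, by simpa using h5, h3.1, h3.2⟩
  · intro h
    have hD : ∀ i, (![{a}, {b}] i : Finset Omega1).card = 1 := by simp [Fin.forall_fin_two]
    have e0 : ∀ x, (Finset.orderEmbOfFin _ (hD 0)) x = a := fun x => by
      simp
    have e1 : ∀ x, (Finset.orderEmbOfFin _ (hD 1)) x = b := fun x => by
      simp
    refine ⟨?_, 1, hD, ∅, le_rfl, by simp, ?_, ?_, ?_, ?_, ?_⟩
    · intro i j hij
      fin_cases i <;> fin_cases j <;> simp_all [hab.symm]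
    · intro i j hij
      fin_cases i <;> fin_cases j <;> simp_all [hab.symm]
    · intro i x hx
      simp at hx
    · intro i j hij
      fin_cases i <;> fin_cases j <;> simp_all [Below, hab.lt_or_gt, hab.lt_or_gt.symm]
    · simp only [Fin.forall_fin_two, e0, e1]
      simp [h.Xi_left, h.Xi_right]
    · intro i j hij x _
      obtain ⟨rfl, rfl⟩ : i = 0 ∧ j = 1 := by revert i j; decide
      rw [e0, e1]
      exact ⟨h.rho_eq, h.delta_eq⟩

lemma capturedPair_iff {a b : Omega1} (hab : a < b) :
    𝓕.CapturedPair a b ↔ ∃ l, 𝓕.CapturedAt a b l := by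
  simp only [CapturedPair, captured_singletons_iff hab.ne]

/-- `a` and `b` lie in the first and in the second piece of `G ∈ 𝓕_{l+1}`, outside the root. -/
structure InFirstTwo (𝓕 : ConstructionScheme τ) (l : ℕ) (G R : Finset Omega1)
    (D : Fin (τ.n (l + 1)) → Finset Omega1) (a b : Omega1) : Prop where
  level : G ∈ 𝓕.level (l + 1)
  canonical : 𝓕.IsCanonical l G R D
  left_mem : a ∈ D (τ.fst l)
  left_notMem : a ∉ R
  right_mem : b ∈ D (τ.snd l)
  right_notMem : b ∉ R

lemma CapturedAt.exists_inFirstTwo {a b : Omega1} {l : ℕ} (h : 𝓕.CapturedAt a b l) :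
    ∃ k, l = k + 1 ∧ 𝓕.kcard a k = 𝓕.kcard b k ∧ ∃ G R D, 𝓕.InFirstTwo k G R D a b := by
  -- Level 0 captures nothing: `Ξ` vanishes there, while the right point needs the value 1.
  obtain _ | k := l
  · have := h.Xi_right
    simp [Xi] at this
  refine ⟨k, rfl, (delta_eq_iff.1 h.delta_eq).1 k (by omega), ?_⟩
  obtain ⟨G, hG, ha, hb⟩ := rho_le_iff.1 h.rho_eq.le
  obtain ⟨R, D, hc⟩ := exists_isCanonical hG
  obtain ⟨i, hi⟩ := (hc.2.2.union a).1 ha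
  obtain ⟨j, hj⟩ := (hc.2.2.union b).1 hb
  have haR : a ∉ R := fun haR => by
    have := hc.Xi_eq_neg_one hG haR
    rw [h.Xi_left] at this
    omega
  have hbR : b ∉ R := fun hbR => by
    have := hc.Xi_eq_neg_one hG hbR
    rw [h.Xi_right] at this
    omega
  have h1 := hc.Xi_eq hG hi haR
  have h2 := hc.Xi_eq hG hj hbR
  rw [h.Xi_left] at h1
  rw [h.Xi_right] at h2
  obtain rfl : i = τ.fst k := Fin.ext (by simp only [SchemeType.fst]; omega)
  obtain rfl : j = τ.snd k := Fin.ext (by simp only [SchemeType.snd]; omega)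
  exact ⟨G, R, D, hG, hc, hi, haR, hj, hbR⟩

namespace InFirstTwo

variable {l : ℕ} {G R : Finset Omega1} {D : Fin (τ.n (l + 1)) → Finset Omega1} {a b : Omega1}
  (h : 𝓕.InFirstTwo l G R D a b)
include h

lemma lt : a < b :=
  h.canonical.2.2.tails (τ.fst l) (τ.snd l) (by simp [SchemeType.fst, SchemeType.snd]) a
    (by simp [h.left_mem, h.left_notMem]) b (by simp [h.right_mem, h.right_notMem])

lemma rho_eq : 𝓕.rho a b = l + 1 := by
  apply le_antisymm
  · exact rho_le_iff.2 ⟨G, h.level, h.canonical.piece_subset _ h.left_mem,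
      h.canonical.piece_subset _ h.right_mem⟩
  · by_contra hlt
    obtain ⟨H, hH, ha, hb⟩ := rho_le_iff.1 (show 𝓕.rho a b ≤ l by omega)
    exact h.left_notMem <| h.canonical.mem_root (τ.fst_ne_snd l) h.left_mem <|
      mem_of_le_of_mem le_rfl hH (h.canonical.1 _) hb h.right_mem ha h.lt.le

lemma capturedAt (hk : 𝓕.kcard a l = 𝓕.kcard b l) : 𝓕.CapturedAt a b (l + 1) where
  Xi_left := by rw [h.canonical.Xi_eq h.level h.left_mem h.left_notMem]; rfl
  Xi_right := by rw [h.canonical.Xi_eq h.level h.right_mem h.right_notMem]; rfl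
  rho_eq := h.rho_eq
  delta_eq := by
    rw [delta_eq_iff]
    refine ⟨fun k hkl => kcard_eq_of_le (Nat.le_of_lt_succ hkl) hk, fun heq => h.lt.ne ?_⟩
    exact kcard_inj h.level (h.canonical.piece_subset _ h.left_mem)
      (h.canonical.piece_subset _ h.right_mem) heq

/-- As `ρ(a, b) - 1 = l`, the closure is the part of the second piece up to `b`; the bound `a`
removes exactly the root. The result no longer mentions `a` or `b`. -/
lemma isLeast_bracket : IsLeast {ξ | ξ ∈ D (τ.snd l) ∧ ξ ∉ R} (𝓕.bracket a b) := by
  classical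
  have hcl : 𝓕.closure b (𝓕.rho a b - 1) = {ξ | ξ ∈ D (τ.snd l) ∧ ξ ≤ b} := by
    rw [h.rho_eq, Nat.add_sub_cancel, closure_eq (h.canonical.1 _) h.right_mem]
  have hset : {ξ | ξ ∈ 𝓕.closure b (𝓕.rho a b - 1) ∧ a ≤ ξ} =
      {ξ | ξ ∈ D (τ.snd l) ∧ ξ ∉ R ∧ ξ ≤ b} := by
    ext ξ
    simp only [hcl, Set.mem_ofPred_eq]
    constructor
    · rintro ⟨⟨h1, h2⟩, h3⟩
      exact ⟨h1, fun h4 => (h.canonical.lt_of_mem_root h4 h.left_mem h.left_notMem).not_ge h3, h2⟩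
    · rintro ⟨h1, h2, h3⟩
      have h' : 𝓕.InFirstTwo l G R D a ξ := { h with right_mem := h1, right_notMem := h2 }
      exact ⟨⟨h1, h3⟩, h'.lt.le⟩
  have hne : {ξ | ξ ∈ 𝓕.closure b (𝓕.rho a b - 1) ∧ a ≤ ξ}.Nonempty := by
    rw [hset]
    exact ⟨b, h.right_mem, h.right_notMem, le_rfl⟩
  rw [bracket, dif_pos hne]
  have hmem := WellFounded.min_mem (wellFounded_lt (α := Omega1)) _ hne
  have hle : ∀ ξ ∈ D (τ.snd l), ξ ∉ R → ξ ≤ b →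
      WellFounded.min (wellFounded_lt (α := Omega1)) _ hne ≤ ξ := fun ξ h1 h2 h3 =>
    not_lt.1 (WellFounded.not_lt_min (wellFounded_lt (α := Omega1)) _
      (by rw [hset]; exact ⟨h1, h2, h3⟩))
  have hmem' := hset.subset hmem
  refine ⟨⟨hmem'.1, hmem'.2.1⟩, fun ξ hξ => ?_⟩
  rcases le_total ξ b with hb | hb
  · exact hle ξ hξ.1 hξ.2 hb
  · exact (hle b h.right_mem h.right_notMem le_rfl).trans hb

lemma bracket_eq {x y : Omega1} (h' : 𝓕.InFirstTwo l G R D x y) :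
    𝓕.bracket x y = 𝓕.bracket a b := h'.isLeast_bracket.unique h.isLeast_bracket

lemma left_mem_of_le {k : ℕ} (hk : k ≤ l) {x : Omega1} (hx : 𝓕.rho x a ≤ k) (hxa : x ≤ a) :
    x ∈ D (τ.fst l) := by
  obtain ⟨E, hE, hxE, haE⟩ := rho_le_iff.1 hx
  exact mem_of_le_of_mem hk hE (h.canonical.1 _) haE h.left_mem hxE hxa

lemma right_mem_of_le {k : ℕ} (hk : k ≤ l) {x : Omega1} (hx : 𝓕.rho x b ≤ k) (hxb : x ≤ b) :
    x ∈ D (τ.snd l) := by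
  obtain ⟨E, hE, hxE, hbE⟩ := rho_le_iff.1 hx
  exact mem_of_le_of_mem hk hE (h.canonical.1 _) hbE h.right_mem hxE hxb

/-- Equal positions at level `k` lift to level `l` along `a` and `b`; there the position decides
root membership, and determines the point if it is in the root. -/
lemma eq_or_inFirstTwo (hab : 𝓕.kcard a l = 𝓕.kcard b l) {k : ℕ} (hk : k ≤ l) {x y : Omega1}
    (hx : 𝓕.rho x a ≤ k) (hxa : x ≤ a) (hy : 𝓕.rho y b ≤ k) (hyb : y ≤ b)
    (hxy : 𝓕.kcard x k = 𝓕.kcard y k) :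
    (x = y ∧ x ∈ R) ∨ (𝓕.InFirstTwo l G R D x y ∧ 𝓕.CapturedAt x y (l + 1)) := by
  have hxD := h.left_mem_of_le hk hx hxa
  have hyD := h.right_mem_of_le hk hy hyb
  have hl := kcard_eq_of_kcard_eq hk hab hxa hx hyb hy hxy
  have h1 := h.canonical.mem_root_iff hxD
  have h2 := h.canonical.mem_root_iff hyD
  by_cases hxR : x ∈ R
  · have hyR : y ∈ R := by rw [h2, ← hl]; exact h1.1 hxR
    exact .inl ⟨kcard_inj (h.canonical.1 _) hxD (h.canonical.root_subset _ hyR) hl, hxR⟩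
  · have hyR : y ∉ R := by rw [h2, ← hl]; exact fun h3 => hxR (h1.2 h3)
    have h' : 𝓕.InFirstTwo l G R D x y := ⟨h.level, h.canonical, hxD, hxR, hyD, hyR⟩
    exact .inr ⟨h', h'.capturedAt hl⟩

end InFirstTwo

lemma CapturedAt.le_of_kcard_eq {a b : Omega1} {l k : ℕ} (h : 𝓕.CapturedAt a b (l + 1))
    (hab : a ≠ b) (hk : 𝓕.kcard a k = 𝓕.kcard b k) : k ≤ l := by
  have := lt_rho_of_kcard_eq hab hk
  rw [h.rho_eq] at this
  omega

/-! ### Capturing pairs of finite sets -/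

lemma card_filter_lt_orderEmbOfFin {α : Type*} [LinearOrder α] (s : Finset α) {m : ℕ}
    (hs : s.card = m) (i : Fin m) : (s.filter (· < s.orderEmbOfFin hs i)).card = i := by
  have : s.filter (· < s.orderEmbOfFin hs i) =
      (Finset.Iio i).map (s.orderEmbOfFin hs).toEmbedding := by
    ext x
    simp only [Finset.mem_filter, Finset.mem_map, Finset.mem_Iio, RelEmbedding.coe_toEmbedding]
    constructor
    · rintro ⟨hx, hlt⟩
      have : x ∈ Set.range (s.orderEmbOfFin hs) := by rwa [Finset.range_orderEmbOfFin]
      obtain ⟨j, rfl⟩ := this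
      exact ⟨j, by simpa using hlt, rfl⟩
    · rintro ⟨j, hj, rfl⟩
      exact ⟨Finset.orderEmbOfFin_mem _ _ _, by simpa using hj⟩
  rw [this, Finset.card_map, Fin.card_Iio]

lemma orderEmbOfFin_mem_iff_of_below {A R : Finset Omega1} (hR : R ⊆ A) (hlt : Below R (A \ R))
    {m : ℕ} (hA : A.card = m) (i : Fin m) : A.orderEmbOfFin hA i ∈ R ↔ (i : ℕ) < R.card := by
  have hi := Finset.orderEmbOfFin_mem A hA i
  conv_rhs => rw [← card_filter_lt_orderEmbOfFin A hA i]
  set x := A.orderEmbOfFin hA i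
  constructor
  · intro hx
    apply Finset.card_lt_card
    rw [Finset.ssubset_iff_of_subset]
    · exact ⟨x, hx, by simp⟩
    · intro y hy
      simp only [Finset.mem_filter] at hy
      by_contra hyR
      exact hy.2.not_gt (hlt x hx y (by simp [hy.1, hyR]))
  · intro h
    by_contra hx
    refine h.not_ge (Finset.card_le_card fun y hy => ?_)
    simp only [Finset.mem_filter]
    exact ⟨hR hy, hlt y hy x (by simp [hi, hx])⟩

/-- The positions in a set of `𝓕_k` of the elements of `A`. -/
noncomputable def positions (𝓕 : ConstructionScheme τ) (k : ℕ) (A : Finset Omega1) : Finset ℕ :=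
  A.image (𝓕.kcard · k)

lemma mem_positions {k : ℕ} {A : Finset Omega1} {x : Omega1} (hx : x ∈ A) :
    𝓕.kcard x k ∈ 𝓕.positions k A := Finset.mem_image_of_mem _ hx

lemma exists_kcard_eq_of_positions_eq {k : ℕ} {A B : Finset Omega1}
    (h : 𝓕.positions k A = 𝓕.positions k B) {x : Omega1} (hx : x ∈ A) :
    ∃ y ∈ B, 𝓕.kcard x k = 𝓕.kcard y k := by
  have := mem_positions (𝓕 := 𝓕) (k := k) hx
  rw [h] at this
  obtain ⟨y, hy, hxy⟩ := Finset.mem_image.1 this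
  exact ⟨y, hy, hxy.symm⟩

lemma card_positions {k : ℕ} {A F : Finset Omega1} (hF : F ∈ 𝓕.level k) (hA : A ⊆ F) :
    (𝓕.positions k A).card = A.card :=
  Finset.card_image_of_injOn fun _ hx _ hy hxy => kcard_inj hF (hA hx) (hA hy) hxy

lemma kcard_orderEmbOfFin {k m : ℕ} {A F : Finset Omega1} (hF : F ∈ 𝓕.level k) (hA : A ⊆ F)
    (hm : A.card = m) (i : Fin m) : 𝓕.kcard (A.orderEmbOfFin hm i) k =
      (𝓕.positions k A).orderEmbOfFin ((card_positions hF hA).trans hm) i := by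
  have := Finset.orderEmbOfFin_unique ((card_positions hF hA).trans hm)
    (f := fun i => 𝓕.kcard (A.orderEmbOfFin hm i) k)
    (fun i => mem_positions (Finset.orderEmbOfFin_mem _ _ _))
    (fun i j hij => kcard_lt_kcard hF (hA (Finset.orderEmbOfFin_mem _ _ _))
      (hA (Finset.orderEmbOfFin_mem _ _ _)) (by simpa using hij))
  exact congrFun this i

/-- Capturing the maxima of `E` and `F` captures all equally placed subsets: corresponding points
either coincide in `R` or form captured pairs, so the Δ-system root is `A ∩ B`. -/
lemma InFirstTwo.captured {l : ℕ} {G R : Finset Omega1}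
    {D : Fin (τ.n (l + 1)) → Finset Omega1} {a b : Omega1} (h : 𝓕.InFirstTwo l G R D a b)
    (hab : 𝓕.kcard a l = 𝓕.kcard b l) {k : ℕ} (hk : k ≤ l) {E F A B : Finset Omega1}
    (hE : E ∈ 𝓕.level k) (hF : F ∈ 𝓕.level k) (ha : IsGreatest (E : Set Omega1) a)
    (hb : IsGreatest (F : Set Omega1) b) (hA : A ⊆ E) (hB : B ⊆ F)
    (hpos : 𝓕.positions k A = 𝓕.positions k B) (hAB : A ≠ B) :
    𝓕.Captured ![A, B] (l + 1) := by
  have key : ∀ {x y}, x ∈ A → y ∈ B → 𝓕.kcard x k = 𝓕.kcard y k →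
      (x = y ∧ x ∈ R) ∨ (𝓕.InFirstTwo l G R D x y ∧ 𝓕.CapturedAt x y (l + 1)) :=
    fun {x y} hx hy hxy => h.eq_or_inFirstTwo hab hk (rho_le_iff.2 ⟨E, hE, hA hx, ha.1⟩)
      (ha.2 (hA hx)) (rho_le_iff.2 ⟨F, hF, hB hy, hb.1⟩) (hb.2 (hB hy)) hxy
  have hAD : ∀ x ∈ A, x ∈ D (τ.fst l) := fun x hx =>
    h.left_mem_of_le hk (rho_le_iff.2 ⟨E, hE, hA hx, ha.1⟩) (ha.2 (hA hx))
  have hBD : ∀ x ∈ B, x ∈ D (τ.snd l) := fun x hx =>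
    h.right_mem_of_le hk (rho_le_iff.2 ⟨F, hF, hB hx, hb.1⟩) (hb.2 (hB hx))
  have hrootA : ∀ x ∈ A, (x ∈ A ∩ B ↔ x ∈ R) := by
    intro x hx
    constructor
    · intro hxB
      exact h.canonical.mem_root (τ.fst_ne_snd l) (hAD x hx) (hBD x (Finset.mem_inter.1 hxB).2)
    · intro hxR
      obtain ⟨y, hy, hxy⟩ := exists_kcard_eq_of_positions_eq hpos hx
      rcases key hx hy hxy with h' | h'
      · exact Finset.mem_inter.2 ⟨hx, h'.1 ▸ hy⟩
      · exact absurd hxR h'.1.left_notMem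
  have hrootB : ∀ x ∈ B, (x ∈ A ∩ B ↔ x ∈ R) := by
    intro x hx
    constructor
    · intro hxB
      exact h.canonical.mem_root (τ.fst_ne_snd l) (hAD x (Finset.mem_inter.1 hxB).1) (hBD x hx)
    · intro hxR
      obtain ⟨y, hy, hxy⟩ := exists_kcard_eq_of_positions_eq hpos.symm hx
      rcases key hy hx hxy.symm with h' | h'
      · exact Finset.mem_inter.2 ⟨h'.1 ▸ hy, hx⟩
      · exact absurd hxR h'.1.right_notMem
  have hbelowA : Below (A ∩ B) (A \ (A ∩ B)) := by
    intro x hx y hy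
    rw [Finset.mem_sdiff] at hy
    have hxA := (Finset.mem_inter.1 hx).1
    exact h.canonical.lt_of_mem_root ((hrootA x hxA).1 hx) (hAD y hy.1)
      fun h' => hy.2 ((hrootA y hy.1).2 h')
  have hbelowB : Below (A ∩ B) (B \ (A ∩ B)) := by
    intro x hx y hy
    rw [Finset.mem_sdiff] at hy
    have hxA := (Finset.mem_inter.1 hx).1
    exact h.canonical.lt_of_mem_root ((hrootA x hxA).1 hx) (hBD y hy.1)
      fun h' => hy.2 ((hrootB y hy.1).2 h')
  have htails : Below (A \ (A ∩ B)) (B \ (A ∩ B)) := by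
    intro x hx y hy
    rw [Finset.mem_sdiff] at hx hy
    exact InFirstTwo.lt ⟨h.level, h.canonical, hAD x hx.1, fun h' => hx.2 ((hrootA x hx.1).2 h'),
      hBD y hy.1, fun h' => hy.2 ((hrootB y hy.1).2 h')⟩
  have hcard : B.card = A.card := by
    rw [← card_positions hE hA, ← card_positions hF hB, hpos]
  have hD : ∀ i, (![A, B] i).card = A.card := by simp [Fin.forall_fin_two, hcard]
  have hne : A.Nonempty := by
    rw [Finset.nonempty_iff_ne_empty]
    rintro rfl
    exact hAB (Finset.card_eq_zero.1 (by simpa using hcard)).symm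
  have hsame : ∀ i : Fin A.card, 𝓕.kcard (A.orderEmbOfFin rfl i) k =
      𝓕.kcard (B.orderEmbOfFin hcard i) k := by
    intro i
    rw [kcard_orderEmbOfFin hE hA, kcard_orderEmbOfFin hF hB]
    congr 2
  refine ⟨?_, A.card, hD, A ∩ B, hne.card_pos, ?_, ?_, ?_, ?_, ?_, ?_⟩
  · intro i j hij
    fin_cases i <;> fin_cases j <;> simp_all [Ne.symm hAB]
  · simp [Fin.forall_fin_two, Finset.inter_subset_left, Finset.inter_subset_right]
  · simp [Fin.forall_fin_two, Finset.inter_comm]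
  · exact Fin.forall_fin_two.2 ⟨hbelowA, hbelowB⟩
  · intro i j hij
    fin_cases i <;> fin_cases j
    · exact absurd rfl hij
    · exact .inl htails
    · exact .inr htails
    · exact absurd rfl hij
  · rw [Fin.forall_fin_two]
    constructor
    · intro i
      change 𝓕.Xi (A.orderEmbOfFin rfl i) (l + 1) = _
      have hi := Finset.orderEmbOfFin_mem A rfl i
      have hiff := (hrootA _ hi).symm.trans
        (orderEmbOfFin_mem_iff_of_below Finset.inter_subset_left hbelowA rfl i)
      split_ifs with hR
      · exact h.canonical.Xi_eq_neg_one h.level (hiff.2 hR)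
      · exact h.canonical.Xi_eq h.level (hAD _ hi) fun h' => hR (hiff.1 h')
    · intro i
      change 𝓕.Xi (B.orderEmbOfFin hcard i) (l + 1) = _
      have hi := Finset.orderEmbOfFin_mem B hcard i
      have hiff := (hrootB _ hi).symm.trans
        (orderEmbOfFin_mem_iff_of_below Finset.inter_subset_right hbelowB hcard i)
      split_ifs with hR
      · exact h.canonical.Xi_eq_neg_one h.level (hiff.2 hR)
      · exact h.canonical.Xi_eq h.level (hBD _ hi) fun h' => hR (hiff.1 h')
  · intro i j hij x hx
    obtain ⟨rfl, rfl⟩ : i = 0 ∧ j = 1 := by revert i j; decide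
    change 𝓕.rho (A.orderEmbOfFin rfl x) (B.orderEmbOfFin hcard x) = _ ∧
      𝓕.delta (A.orderEmbOfFin rfl x) (B.orderEmbOfFin hcard x) = _
    have hxA := Finset.orderEmbOfFin_mem A rfl x
    rcases key hxA (Finset.orderEmbOfFin_mem B hcard x) (hsame x) with h' | h'
    · rw [← hrootA _ hxA, orderEmbOfFin_mem_iff_of_below Finset.inter_subset_left hbelowA] at h'
      omega
    · exact ⟨h'.2.rho_eq, h'.2.delta_eq⟩

/-- The brackets of a union of two conditions that are glued along a captured pair. -/
lemma InFirstTwo.brackets_union_subset {l : ℕ} {G R : Finset Omega1}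
    {D : Fin (τ.n (l + 1)) → Finset Omega1} {a b : Omega1} (h : 𝓕.InFirstTwo l G R D a b)
    (hab : 𝓕.kcard a l = 𝓕.kcard b l) {k : ℕ} (hk : k ≤ l) {E F A B : Finset Omega1}
    (hE : E ∈ 𝓕.level k) (hF : F ∈ 𝓕.level k) (ha : IsGreatest (E : Set Omega1) a)
    (hb : IsGreatest (F : Set Omega1) b) (hA : A ⊆ E) (hB : B ⊆ F)
    (hpos : 𝓕.positions k A = 𝓕.positions k B) :
    𝓕.brackets ((A ∪ B : Finset Omega1) : Set Omega1) ⊆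
      insert (𝓕.bracket a b) (𝓕.brackets A ∪ 𝓕.brackets B) := by
  have key : ∀ {x y}, x ∈ A → y ∈ B → 𝓕.kcard x k = 𝓕.kcard y k →
      (x = y ∧ x ∈ R) ∨ (𝓕.InFirstTwo l G R D x y ∧ 𝓕.CapturedAt x y (l + 1)) :=
    fun {x y} hx hy hxy => h.eq_or_inFirstTwo hab hk (rho_le_iff.2 ⟨E, hE, hA hx, ha.1⟩)
      (ha.2 (hA hx)) (rho_le_iff.2 ⟨F, hF, hB hy, hb.1⟩) (hb.2 (hB hy)) hxy
  -- A point of `A` in the root equals its counterpart in `B`, so new cross pairs live in the two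
  -- tails and all have the bracket of `a` and `b`.
  have hleft : ∀ x ∈ A, x ∉ B → x ∈ D (τ.fst l) ∧ x ∉ R := by
    intro x hx hxB
    refine ⟨h.left_mem_of_le hk (rho_le_iff.2 ⟨E, hE, hA hx, ha.1⟩) (ha.2 (hA hx)), fun hxR => ?_⟩
    obtain ⟨y, hy, hxy⟩ := exists_kcard_eq_of_positions_eq hpos hx
    rcases key hx hy hxy with h' | h'
    · exact hxB (h'.1 ▸ hy)
    · exact h'.1.left_notMem hxR
  have hright : ∀ x ∈ B, x ∉ A → x ∈ D (τ.snd l) ∧ x ∉ R := by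
    intro x hx hxA
    refine ⟨h.right_mem_of_le hk (rho_le_iff.2 ⟨F, hF, hB hx, hb.1⟩) (hb.2 (hB hx)), fun hxR => ?_⟩
    obtain ⟨y, hy, hxy⟩ := exists_kcard_eq_of_positions_eq hpos.symm hx
    rcases key hy hx hxy.symm with h' | h'
    · exact hxA (h'.1 ▸ hy)
    · exact h'.1.right_notMem hxR
  rintro δ ⟨x, hx, y, hy, hxy, hc, rfl⟩
  simp only [Finset.coe_union, Set.mem_union, Finset.mem_coe] at hx hy
  by_cases hAA : x ∈ A ∧ y ∈ A
  · exact .inr (.inl ⟨x, hAA.1, y, hAA.2, hxy, hc, rfl⟩)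
  by_cases hBB : x ∈ B ∧ y ∈ B
  · exact .inr (.inr ⟨x, hBB.1, y, hBB.2, hxy, hc, rfl⟩)
  by_cases hxA : x ∈ A
  · have hyB : y ∈ B := by tauto
    obtain ⟨h1, h2⟩ := hleft x hxA (by tauto)
    obtain ⟨h3, h4⟩ := hright y hyB (by tauto)
    exact .inl (h.bracket_eq ⟨h.level, h.canonical, h1, h2, h3, h4⟩)
  · have hxB : x ∈ B := by tauto
    have hyA : y ∈ A := by tauto
    obtain ⟨h1, h2⟩ := hleft y hyA (by tauto)
    obtain ⟨h3, h4⟩ := hright x hxB (by tauto)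
    exact absurd (InFirstTwo.lt ⟨h.level, h.canonical, h1, h2, h3, h4⟩) hxy.not_gt

lemma brackets_mono {S T : Set Omega1} (h : S ⊆ T) : 𝓕.brackets S ⊆ 𝓕.brackets T := by
  rintro δ ⟨x, hx, y, hy, h'⟩
  exact ⟨x, h hx, y, h hy, h'⟩

end ConstructionScheme
end ConstructionSchemes

namespace ConstructionSchemes

/-! ### Uncountable subsets of `ω₁` -/

lemma countable_Iio (x : Omega1) : (Set.Iio x).Countable := by
  have h := Cardinal.mk_Iio_lt x (by simp)
  rw [Cardinal.mk_toType, Ordinal.card_omega] at h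
  rwa [← Cardinal.le_aleph0_iff_set_countable, ← Order.lt_succ_iff, Cardinal.succ_aleph0]

lemma countable_Iic (x : Omega1) : (Set.Iic x).Countable := by
  rw [← Set.Iio_insert]
  exact (countable_Iio x).insert x

lemma not_countable_univ : ¬ (Set.univ : Set Omega1).Countable := by
  rw [← Cardinal.le_aleph0_iff_set_countable, Cardinal.mk_univ, not_le]
  simp

lemma exists_forall_lt_of_countable {S : Set Omega1} (hS : S.Countable) : ∃ γ, ∀ x ∈ S, x < γ := by
  by_contra! h
  refine not_countable_univ ((hS.biUnion fun x _ => countable_Iic x).mono fun γ _ => ?_)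
  obtain ⟨x, hx, hγ⟩ := h γ
  exact Set.mem_biUnion hx hγ

lemma exists_gt_of_not_countable {S : Set Omega1} (hS : ¬ S.Countable) (γ : Omega1) :
    ∃ x ∈ S, γ < x := by
  by_contra! h
  exact hS ((countable_Iic γ).mono h)

lemma not_countable_of_forall_exists_ge {S : Set Omega1} (hS : ∀ γ, ∃ x ∈ S, γ ≤ x) :
    ¬ S.Countable := by
  intro h
  obtain ⟨γ, hγ⟩ := exists_forall_lt_of_countable h
  obtain ⟨x, hx, hle⟩ := hS γ
  exact (hγ x hx).not_ge hle

/-- Every `α : ω₁ → ω₁` has an uncountable set of closure points. -/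
lemma exists_not_countable_forall_lt (α : Omega1 → Omega1) :
    ∃ C : Set Omega1, ¬ C.Countable ∧ ∀ x ∈ C, ∀ y ∈ C, y < x → α y ≤ x := by
  let M : Omega1 → Prop :=
    (wellFounded_lt (α := Omega1)).fix fun x ih => ∀ y (hy : y < x), ih y hy → α y ≤ x
  have hM : ∀ x, M x ↔ ∀ y < x, M y → α y ≤ x := fun x => by
    rw [← eq_iff_iff]
    exact WellFounded.fix_eq _ _ x
  refine ⟨{x | M x}, fun hc => ?_, fun x hx y hy hyx => (hM x).1 hx y hyx hy⟩
  obtain ⟨γ, hγ⟩ := exists_forall_lt_of_countable (hc.union (hc.image α))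
  have : M γ := (hM γ).2 fun y _ hy => (hγ _ (.inr ⟨y, hy, rfl⟩)).le
  exact (hγ γ (.inl this)).false

lemma exists_fiber_not_countable {α β : Type*} [Countable β] {S : Set α} (hS : ¬ S.Countable)
    (f : α → β) : ∃ b, ¬ (S ∩ f ⁻¹' {b}).Countable := by
  by_contra! h
  refine hS ((Set.countable_iUnion h).mono fun x hx => ?_)
  exact Set.mem_iUnion.2 ⟨f x, hx, rfl⟩

namespace ConstructionScheme

variable {τ : SchemeType} {𝓕 : ConstructionScheme τ}

/-! ### Brackets -/

lemma CapturedAt.lt {a b : Omega1} {l : ℕ} (h : 𝓕.CapturedAt a b l) : a < b := by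
  obtain ⟨k, -, -, G, R, D, h'⟩ := h.exists_inFirstTwo
  exact h'.lt

lemma lt_bracket {a b : Omega1} (hab : a < b) (h : 𝓕.CapturedPair a b) : a < 𝓕.bracket a b := by
  obtain ⟨l, hl⟩ := (capturedPair_iff hab).1 h
  obtain ⟨k, -, -, G, R, D, h'⟩ := hl.exists_inFirstTwo
  obtain ⟨h1, h2⟩ := h'.isLeast_bracket.1
  exact InFirstTwo.lt { h' with right_mem := h1, right_notMem := h2 }

lemma finite_brackets {S : Set Omega1} (hS : S.Finite) : (𝓕.brackets S).Finite := by
  refine (hS.image2 𝓕.bracket hS).subset ?_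
  rintro δ ⟨x, hx, y, hy, -, -, rfl⟩
  exact ⟨x, hx, y, hy, rfl⟩

lemma brackets_eq_empty {S : Set Omega1} (hS : S.Subsingleton) : 𝓕.brackets S = ∅ := by
  rw [Set.eq_empty_iff_forall_notMem]
  rintro δ ⟨x, hx, y, hy, hxy, -⟩
  exact hxy.ne (hS hx hy)

lemma nonempty_brackets (h𝓕 : 𝓕.IsCapturing 2) {S : Set Omega1} (hS : ¬ S.Countable) :
    (𝓕.brackets S).Nonempty := by
  let f : Omega1 → FinSets := fun x => ⟨{x}, Finset.singleton_nonempty x⟩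
  have hf : Function.Injective f := fun x y hxy => by simpa [f] using hxy
  obtain ⟨l, D, hD, hc⟩ := (h𝓕 (f '' S)
    fun h => hS (Set.countable_of_injective_of_countable_image hf.injOn h)).nonempty
  obtain ⟨a, ha, ha'⟩ := hD 0
  obtain ⟨b, hb, hb'⟩ := hD 1
  have hab : a ≠ b := by
    rintro rfl
    have : (0 : Fin 2) = 1 := hc.1 (by simp [← ha', ← hb'])
    exact absurd this (by decide)
  have hDD : (fun i => (D i : Finset Omega1)) = ![{a}, {b}] := by
    funext i
    fin_cases i
    · simp [← ha', f]
    · simp [← hb', f]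
  rw [hDD] at hc
  exact ⟨_, a, ha, b, hb, ((captured_singletons_iff hab).1 hc).lt, ⟨l, hc⟩, rfl⟩

lemma not_countable_brackets (h𝓕 : 𝓕.IsCapturing 2) {S : Set Omega1} (hS : ¬ S.Countable) :
    ¬ (𝓕.brackets S).Countable := by
  refine not_countable_of_forall_exists_ge fun γ => ?_
  have hS' : ¬ (S ∩ Set.Ioi γ).Countable := fun h => hS <|
    (h.union (countable_Iic γ)).mono fun x hx => (le_or_gt x γ).symm.imp (fun h => ⟨hx, h⟩) id
  obtain ⟨δ, x, hx, y, hy, hxy, hc, rfl⟩ := nonempty_brackets h𝓕 hS'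
  exact ⟨_, ⟨x, hx.1, y, hy.1, hxy, hc, rfl⟩, (hx.2.trans (lt_bracket hxy hc)).le⟩

/-! ### The filter property -/

/-- Attach to `x ∈ S` a larger `σ x ∈ T`, with the pair's level and positions fixed on an
uncountable `Y`. A pair captured in `σ '' Y` then induces a captured pair in `Y` with the same
bracket. -/
lemma exists_brackets_subset_inter {S T : Set Omega1} (hS : ¬ S.Countable) (hT : ¬ T.Countable) :
    ∃ X : Set Omega1, ¬ X.Countable ∧ 𝓕.brackets X ⊆ 𝓕.brackets S ∩ 𝓕.brackets T := by
  choose σ hσT hσ using fun x => exists_gt_of_not_countable hT x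
  choose k _ F hF hsub using fun x =>
    exists_level_superset (𝓕 := 𝓕) (Finset.insert_nonempty x {σ x}) 0
  obtain ⟨⟨k₀, c, d⟩, hY⟩ := exists_fiber_not_countable hS
    fun x => (k x, 𝓕.kcard x (k x), 𝓕.kcard (σ x) (k x))
  set Y := S ∩ (fun x => (k x, 𝓕.kcard x (k x), 𝓕.kcard (σ x) (k x))) ⁻¹' {(k₀, c, d)}
  have hdata : ∀ x ∈ Y, x ∈ S ∧ 𝓕.rho x (σ x) ≤ k₀ ∧ 𝓕.kcard x k₀ = c ∧ 𝓕.kcard (σ x) k₀ = d := by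
    rintro x ⟨hxS, hx⟩
    simp only [Set.mem_preimage, Set.mem_singleton_iff, Prod.mk.injEq] at hx
    obtain ⟨rfl, rfl, rfl⟩ := hx
    exact ⟨hxS, rho_le_iff.2 ⟨F x, hF x, hsub x (by simp), hsub x (by simp)⟩, rfl, rfl⟩
  -- `x` is recovered from `σ x` as the point at position `c` in a level `k₀` set containing `σ x`.
  have hinj : Set.InjOn σ Y := by
    intro x hx y hy hxy
    obtain ⟨-, hρ, hx', -⟩ := hdata x hx
    obtain ⟨-, hρ', hy', -⟩ := hdata y hy
    obtain ⟨E, hE, h1, h2⟩ := rho_le_iff.1 hρ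
    obtain ⟨E', hE', h3, h4⟩ := rho_le_iff.1 hρ'
    rw [← hxy] at h4
    exact kcard_inj hE' (mem_of_le_of_mem le_rfl hE hE' h2 h4 h1 (hσ x).le) h3 (hx'.trans hy'.symm)
  refine ⟨σ '' Y, fun h => hY (Set.countable_of_injective_of_countable_image hinj h), ?_⟩
  rintro δ ⟨_, ⟨x, hx, rfl⟩, _, ⟨y, hy, rfl⟩, hlt, hc, rfl⟩
  refine ⟨?_, σ x, hσT x, σ y, hσT y, hlt, hc, rfl⟩
  obtain ⟨l', hl⟩ := (capturedPair_iff hlt).1 hc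
  obtain ⟨l, rfl, hkl, G, R, D, h⟩ := hl.exists_inFirstTwo
  obtain ⟨hxS, hρ, hx', hσx⟩ := hdata x hx
  obtain ⟨hyS, hρ', hy', hσy⟩ := hdata y hy
  have hk := hl.le_of_kcard_eq hlt.ne (hσx.trans hσy.symm)
  rcases h.eq_or_inFirstTwo hkl hk hρ (hσ x).le hρ' (hσ y).le (hx'.trans hy'.symm) with h' | h'
  · exact absurd (congrArg σ h'.1) hlt.ne
  · exact ⟨x, hxS, y, hyS, h'.1.lt, (capturedPair_iff h'.1.lt).2 ⟨_, h'.2⟩,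
      (h.bracket_eq h'.1).symm⟩

/-! ### Gluing conditions -/

/-- The family `Q` of sets of colours is closed under subsets, and every finite member of `Q` can be
extended by the colour of a bracket of every uncountable set. -/
structure Extendible (𝓕 : ConstructionScheme τ) (h : Omega1 → ℕ) (Q : Set (Set ℕ)) : Prop where
  empty_mem : ∅ ∈ Q
  mono : ∀ q ∈ Q, ∀ q' ⊆ q, q' ∈ Q
  extend : ∀ q ∈ Q, q.Finite → ∀ S : Set Omega1, ¬ S.Countable →
    ∃ z ∈ 𝓕.brackets S, insert (h z) q ∈ Q

lemma kcard_succ_of_isGreatest {k : ℕ} {F : Finset Omega1} (hF : F ∈ 𝓕.level k) {a : Omega1}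
    (ha : IsGreatest (F : Set Omega1) a) : 𝓕.kcard a k + 1 = τ.m k := by
  have : F.filter (· < a) = F.erase a := by
    ext x
    simp only [Finset.mem_filter, Finset.mem_erase]
    exact ⟨fun h => ⟨h.2.ne, h.1⟩, fun h => ⟨h.2, (ha.2 h.2).lt_of_ne h.1⟩⟩
  rw [kcard_eq hF ha.1, this, Finset.card_erase_add_one ha.1, hF.2]

lemma eq_of_positions_eq {k : ℕ} {F A B : Finset Omega1} (hF : F ∈ 𝓕.level k) (hA : A ⊆ F)
    (hB : B ⊆ F) (h : 𝓕.positions k A = 𝓕.positions k B) : A = B := by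
  refine Finset.Subset.antisymm (fun x hx => ?_) (fun x hx => ?_)
  · obtain ⟨y, hy, hxy⟩ := exists_kcard_eq_of_positions_eq h hx
    rwa [kcard_inj hF (hA hx) (hB hy) hxy]
  · obtain ⟨y, hy, hxy⟩ := exists_kcard_eq_of_positions_eq h.symm hx
    rwa [kcard_inj hF (hB hx) (hA hy) hxy]

/-- This serves both the ccc and preservation: enclose `A i` and `p i` in one set of the scheme,
make level, positions and colours constant, and apply `extend` to the set of maxima. -/
lemma Extendible.exists_captured_union {h : Omega1 → ℕ} {Q : Set (Set ℕ)}
    (hQ : 𝓕.Extendible h Q) {ι : Type} {X : Set ι} (hX : ¬ X.Countable) (A p : ι → Finset Omega1)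
    (hA : Set.InjOn A X) (hp : ∀ i ∈ X, h '' 𝓕.brackets (p i) ∈ Q) (k₀ : ℕ) :
    ∃ i ∈ X, ∃ j ∈ X, i ≠ j ∧ (∃ l ≥ k₀, 𝓕.Captured ![A i, A j] l) ∧
      h '' 𝓕.brackets ((p i ∪ p j : Finset Omega1) : Set Omega1) ∈ Q := by
  -- The extra point covers the case where `A i ∪ p i` is empty. Levels at least `k₀` force the
  -- capturing level above `k₀`.
  obtain ⟨x₀⟩ : Nonempty Omega1 := inferInstance
  choose k hk F hF hsub using fun i =>
    exists_level_superset (𝓕 := 𝓕) (Finset.insert_nonempty x₀ (A i ∪ p i)) k₀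
  have hfin : ∀ i, (h '' 𝓕.brackets (p i)).Finite := fun i =>
    (finite_brackets (p i).finite_toSet).image h
  let f : ι → ℕ × Finset ℕ × Finset ℕ × Finset ℕ := fun i =>
    (k i, 𝓕.positions (k i) (A i), 𝓕.positions (k i) (p i), (hfin i).toFinset)
  obtain ⟨⟨κ, u, v, w⟩, hY⟩ := exists_fiber_not_countable hX f
  have hdata : ∀ i ∈ X ∩ f ⁻¹' {(κ, u, v, w)}, i ∈ X ∧ k₀ ≤ κ ∧ F i ∈ 𝓕.level κ ∧
      𝓕.positions κ (A i) = u ∧ 𝓕.positions κ (p i) = v ∧ h '' 𝓕.brackets (p i) = w := by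
    rintro i ⟨hiX, hi⟩
    simp only [f, Set.mem_preimage, Set.mem_singleton_iff, Prod.mk.injEq] at hi
    obtain ⟨rfl, rfl, rfl, rfl⟩ := hi
    exact ⟨hiX, hk i, hF i, rfl, rfl, by simp⟩
  generalize X ∩ f ⁻¹' {(κ, u, v, w)} = Y at hY hdata
  have hAF : ∀ i, A i ⊆ F i := fun i x hx => hsub i (by simp [hx])
  have hpF : ∀ i, p i ⊆ F i := fun i x hx => hsub i (by simp [hx])
  choose a ha using fun i =>
    (⟨_, (F i).isGreatest_max' (nonempty_of_mem_level (hF i))⟩ :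
      ∃ a, IsGreatest (F i : Set Omega1) a)
  have hinj : Set.InjOn a Y := by
    intro i hi j hj hij
    obtain ⟨hiX, -, hFi, hui, -⟩ := hdata i hi
    obtain ⟨hjX, -, hFj, huj, -⟩ := hdata j hj
    refine hA hiX hjX (eq_of_positions_eq hFj (fun x hx => ?_) (hAF j) (hui.trans huj.symm))
    exact mem_of_le_of_mem le_rfl hFi hFj (ha i).1 (hij ▸ (ha j).1) (hAF i hx) ((ha i).2 (hAF i hx))
  have hYne : Y.Nonempty := Set.nonempty_iff_ne_empty.2 fun h0 => hY (h0 ▸ Set.countable_empty)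
  have hw : (w : Set ℕ) ∈ Q := by
    obtain ⟨i, hi⟩ := hYne
    obtain ⟨hiX, -, -, -, -, hwi⟩ := hdata i hi
    exact hwi ▸ hp i hiX
  obtain ⟨_, ⟨_, ⟨i, hi, rfl⟩, _, ⟨j, hj, rfl⟩, hlt, hc, rfl⟩, hz⟩ :=
    hQ.extend w hw w.finite_toSet (a '' Y)
      fun h => hY (Set.countable_of_injective_of_countable_image hinj h)
  obtain ⟨l', hl⟩ := (capturedPair_iff hlt).1 hc
  obtain ⟨l, rfl, hkl, G, R, D, hg⟩ := hl.exists_inFirstTwo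
  obtain ⟨hiX, hκ, hFi, hui, hvi, hwi⟩ := hdata i hi
  obtain ⟨hjX, -, hFj, huj, hvj, hwj⟩ := hdata j hj
  have hij : i ≠ j := fun h => hlt.ne (congrArg a h)
  -- Both maxima have position `m κ - 1`, so they agree at level `κ`.
  have hκl : κ ≤ l := hl.le_of_kcard_eq hlt.ne (Nat.succ_injective
    ((kcard_succ_of_isGreatest hFi (ha i)).trans (kcard_succ_of_isGreatest hFj (ha j)).symm))
  refine ⟨i, hiX, j, hjX, hij, ⟨l + 1, by omega, ?_⟩, hQ.mono _ hz _ ?_⟩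
  · exact hg.captured hkl hκl hFi hFj (ha i) (ha j) (hAF i) (hAF j) (hui.trans huj.symm)
      fun h => hij (hA hiX hjX h)
  · refine (Set.image_mono (hg.brackets_union_subset hkl hκl hFi hFj (ha i) (ha j) (hpF i) (hpF j)
      (hvi.trans hvj.symm))).trans ?_
    rw [Set.image_insert_eq, Set.image_union, hwi, hwj, Set.union_self]

/-! ### The forcing notion -/

/-- The finite supersets `p` of `p₀` for which the colours of the brackets of `p` form a member of
`Q`, ordered by reverse inclusion. -/
def Condition (𝓕 : ConstructionScheme τ) (h : Omega1 → ℕ) (Q : Set (Set ℕ))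
    (p₀ : Finset Omega1) : Type :=
  {p : Finset Omega1 // p₀ ⊆ p ∧ h '' 𝓕.brackets (p : Set Omega1) ∈ Q}

variable {h : Omega1 → ℕ} {Q : Set (Set ℕ)} {p₀ : Finset Omega1}

instance : Preorder (𝓕.Condition h Q p₀) where
  le p q := q.1 ⊆ p.1
  le_refl _ := subset_rfl
  le_trans _ _ _ h1 h2 := h2.trans h1

lemma Condition.le_def {p q : 𝓕.Condition h Q p₀} : p ≤ q ↔ q.1 ⊆ p.1 := Iff.rfl

/-- The largest condition. -/
@[reducible]
def Condition.orderTop (hp₀ : h '' 𝓕.brackets (p₀ : Set Omega1) ∈ Q) :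
    OrderTop (𝓕.Condition h Q p₀) where
  top := ⟨p₀, subset_rfl, hp₀⟩
  le_top p := p.2.1

lemma Extendible.ccc (hQ : 𝓕.Extendible h Q) : CCC (𝓕.Condition h Q p₀) := by
  intro A hA
  by_contra hunc
  obtain ⟨p, hp, q, hq, hpq, -, hu⟩ := hQ.exists_captured_union hunc (fun p => p.1) (fun p => p.1)
    Subtype.val_injective.injOn (fun p _ => p.2.2) 0
  exact hA p hp q hq hpq ⟨⟨p.1 ∪ q.1, p.2.1.trans Finset.subset_union_left, hu⟩,
    Finset.subset_union_left, Finset.subset_union_right⟩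

end ConstructionScheme

/-! ### Preservation of capturing and generic sets -/

lemma not_countable_of_forces {P : Type} [Preorder P] {X : Type} {S : Name P X} {p : P}
    (hp : ¬ Sentence.countable S p) : ¬ {x | ∃ s ≤ p, ∃ t ∈ S x, s ≤ t}.Countable := by
  intro hc
  obtain ⟨e, he⟩ := Set.countable_iff_exists_injOn.1 hc
  -- If only countably many `x` can enter `S` below `p`, the ground-model injection `e` restricted
  -- to them is named by all-or-nothing sets of conditions.
  refine hp fun r hr => ⟨r, le_rfl,
    fun z => {_t | (∃ s ≤ p, ∃ t ∈ S z.1, s ≤ t) ∧ e z.1 = z.2}, ?_, ?_, ?_⟩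
  · intro x u hu hx v hv
    obtain ⟨s, hs, t, ht, hst⟩ := hx v hv
    exact ⟨v, le_rfl, e x, fun w hw => ⟨w, le_rfl, w,
      ⟨⟨s, hs.trans (hv.trans (hu.trans hr)), t, ht, hst⟩, rfl⟩, le_rfl⟩⟩
  · rintro x i j u hu ⟨h1, h2⟩
    obtain ⟨_, _, _, h3, _⟩ := h1 u le_rfl
    obtain ⟨_, _, _, h4, _⟩ := h2 u le_rfl
    exact h3.2.symm.trans h4.2
  · rintro x y i u hu ⟨h1, h2⟩
    obtain ⟨_, _, _, h3, _⟩ := h1 u le_rfl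
    obtain ⟨_, _, _, h4, _⟩ := h2 u le_rfl
    exact he h3.1 h4.1 (h3.2.trans h4.2.symm)

namespace ConstructionScheme

variable {τ : SchemeType} {𝓕 : ConstructionScheme τ} {h : Omega1 → ℕ} {Q : Set (Set ℕ)}
  {p₀ : Finset Omega1}

lemma Extendible.preserves (hQ : 𝓕.Extendible h Q) [OrderTop (𝓕.Condition h Q p₀)] :
    Preserves (𝓕.Condition h Q p₀) 2 𝓕 := by
  intro S q _ hS k q' hq'
  have hX := not_countable_of_forces (hS q' hq')
  have : Nonempty (𝓕.Condition h Q p₀) := ⟨q'⟩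
  have hX' : ∀ x ∈ {x | ∃ s ≤ q', ∃ t ∈ S x, s ≤ t}, ∃ s, s ≤ q' ∧ ∃ t ∈ S x, s ≤ t :=
    fun x hx => hx
  choose! s hs t ht hst using hX'
  obtain ⟨x, hx, y, hy, hxy, ⟨l, hl, hc⟩, hu⟩ := hQ.exists_captured_union hX Subtype.val
    (fun x => (s x).1) Subtype.val_injective.injOn (fun x _ => (s x).2.2) k
  let r : 𝓕.Condition h Q p₀ :=
    ⟨(s x).1 ∪ (s y).1, (s x).2.1.trans Finset.subset_union_left, hu⟩
  have hrx : r ≤ s x := Finset.subset_union_left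
  have hry : r ≤ s y := Finset.subset_union_right
  refine ⟨r, hrx.trans (hs x hx), l, fun u hu => ⟨u, le_rfl, ![x, y], ⟨hl, ?_⟩, ?_⟩⟩
  · convert hc using 1
    funext i
    fin_cases i <;> rfl
  · rw [Sentence.all, Fin.forall_fin_two]
    exact ⟨fun v hv => ⟨v, le_rfl, t x, ht x hx, (hv.trans hu).trans (hrx.trans (hst x hx))⟩,
      fun v hv => ⟨v, le_rfl, t y, ht y hy, (hv.trans hu).trans (hry.trans (hst y hy))⟩⟩

/-- Otherwise each `x` has a condition `q x ∋ x` with no extension reaching `α x`. On an uncountable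
set closed under `α`, two such conditions have compatible union, and the larger index exceeds the
bound of the smaller. -/
lemma Extendible.exists_unbounded_condition (hQ : 𝓕.Extendible h Q) :
    ∃ x₀ : Omega1, ∀ (q : 𝓕.Condition h Q {x₀}) (α : Omega1), ∃ r ≤ q, ∃ y ∈ r.1, α ≤ y := by
  by_contra! hcon
  choose q α hα using hcon
  obtain ⟨C, hC, hC'⟩ := exists_not_countable_forall_lt α
  obtain ⟨x, hx, y, hy, hxy, -, hu⟩ := hQ.exists_captured_union hC (fun x => {x})
    (fun x => (q x).1) (Finset.singleton_injective.injOn) (fun x _ => (q x).2.2) 0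
  have hxq : x ∈ (q x).1 := Finset.singleton_subset_iff.1 (q x).2.1
  have hyq : y ∈ (q y).1 := Finset.singleton_subset_iff.1 (q y).2.1
  rcases hxy.lt_or_gt with hlt | hlt
  · exact (hα x ⟨(q x).1 ∪ (q y).1, (q x).2.1.trans Finset.subset_union_left, hu⟩
      Finset.subset_union_left y (Finset.mem_union_right _ hyq)).not_ge (hC' y hy x hx hlt)
  · exact (hα y ⟨(q x).1 ∪ (q y).1, (q y).2.1.trans Finset.subset_union_right, hu⟩
      Finset.subset_union_right x (Finset.mem_union_left _ hxq)).not_ge (hC' x hx y hy hlt)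

lemma exists_filter_of_aleph_one_lt (h𝓕 : 𝓕.IsCapturing 2)
    (hm : ((Cardinal.aleph 1 : Cardinal.{0}) : WithTop Cardinal.{0}) < 𝓕.martinNumber 2)
    (P : Type) [Preorder P] [OrderTop P] (hP : CCC P) (hP' : Preserves P 2 𝓕) {ι : Type}
    (hι : Cardinal.mk ι ≤ Cardinal.aleph 1) (E : ι → Set P) (hE : ∀ i, IsDenseSet (E i)) :
    ∃ G : Order.PFilter P, ∀ i, ∃ p ∈ E i, p ∈ G := by
  by_contra hG
  have h1 : 𝓕.martinNumber 2 ≤ ConstructionSchemes.martinNumber P := by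
    rw [martinNumber, if_pos h𝓕]
    exact iInf_le_of_le P (iInf_le_of_le _ (iInf_le_of_le _ (iInf_le_of_le ⟨hP, hP'⟩ le_rfl)))
  have h2 : ConstructionSchemes.martinNumber P ≤ (Cardinal.mk (Set.range E) : Cardinal.{0}) := by
    refine iInf₂_le (Set.range E) ⟨?_, ?_⟩
    · rintro _ ⟨i, rfl⟩
      exact hE i
    · simpa using hG
  have h3 : ((Cardinal.mk (Set.range E) : Cardinal.{0}) : WithTop Cardinal.{0}) ≤
      (Cardinal.aleph 1 : Cardinal.{0}) :=
    WithTop.coe_le_coe.2 (Cardinal.mk_range_le.trans hι)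
  exact (hm.trans_le (h1.trans (h2.trans h3))).false

/-- The union of a filter meeting the `ω₁` dense sets "some point is at least `α`" is uncountable,
and directedness puts each finite subset inside one condition. -/
theorem Extendible.exists_homogeneous (hQ : 𝓕.Extendible h Q) (h𝓕 : 𝓕.IsCapturing 2)
    (hm : ((Cardinal.aleph 1 : Cardinal.{0}) : WithTop Cardinal.{0}) < 𝓕.martinNumber 2) :
    ∃ S : Set Omega1, ¬ S.Countable ∧
      ∀ p : Finset Omega1, (p : Set Omega1) ⊆ S → h '' 𝓕.brackets p ∈ Q := by
  obtain ⟨x₀, hx₀⟩ := hQ.exists_unbounded_condition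
  let _ : OrderTop (𝓕.Condition h Q {x₀}) := Condition.orderTop <| by
    rw [brackets_eq_empty (by simp), Set.image_empty]
    exact hQ.empty_mem
  obtain ⟨G, hG⟩ := exists_filter_of_aleph_one_lt h𝓕 hm (𝓕.Condition h Q {x₀}) hQ.ccc hQ.preserves
    (ι := Omega1) (by simp) (fun α => {r | ∃ y ∈ r.1, α ≤ y}) fun α q => by
      obtain ⟨r, hr, hr'⟩ := hx₀ q α
      exact ⟨r, hr', hr⟩
  refine ⟨{x | ∃ r ∈ G, x ∈ r.1}, not_countable_of_forall_exists_ge fun γ => ?_, fun p hp => ?_⟩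
  · obtain ⟨r, ⟨y, hy, hle⟩, hr⟩ := hG γ
    exact ⟨y, ⟨r, hr, hy⟩, hle⟩
  · obtain ⟨r, hr, hpr⟩ : ∃ r ∈ G, p ⊆ r.1 := by
      induction p using Finset.induction_on with
      | empty =>
        obtain ⟨r, hr⟩ := G.nonempty
        exact ⟨r, hr, Finset.empty_subset _⟩
      | insert x p _ ih =>
        rw [Finset.coe_insert, Set.insert_subset_iff] at hp
        obtain ⟨r, hr, hpr⟩ := ih hp.2
        obtain ⟨r', hr', hxr'⟩ := hp.1
        obtain ⟨s, hs, hsr, hsr'⟩ := G.directed r hr r' hr'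
        exact ⟨s, hs, Finset.insert_subset (hsr' hxr') (hpr.trans hsr)⟩
    exact hQ.mono _ r.2.2 _ (Set.image_mono (brackets_mono (Finset.coe_subset.2 hpr)))

/-! ### The square-bracket ultrafilter -/

lemma mem_or_compl_mem_squareBracketFilter (h𝓕 : 𝓕.IsCapturing 2)
    (hm : ((Cardinal.aleph 1 : Cardinal.{0}) : WithTop Cardinal.{0}) < 𝓕.martinNumber 2)
    (A : Set Omega1) : A ∈ 𝓕.squareBracketFilter ∨ Aᶜ ∈ 𝓕.squareBracketFilter := by
  classical
  by_contra! hcon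
  -- As `A` is not in the filter, every uncountable set has a bracket outside `A`, of colour 0. A
  -- homogeneous set then has all its brackets in `Aᶜ`.
  have hQ : 𝓕.Extendible (fun x => if x ∈ A then 1 else 0) {q | 1 ∉ q} := by
    refine ⟨by simp, fun q hq q' hq' h1 => hq (hq' h1), fun q hq _ S hS => ?_⟩
    obtain ⟨z, hz, hzA⟩ := Set.not_subset.1 fun hSA => hcon.1 ⟨S, hS, hSA⟩
    exact ⟨z, hz, by simpa [hzA] using hq⟩
  obtain ⟨S, hS, hS'⟩ := hQ.exists_homogeneous h𝓕 hm
  refine hcon.2 ⟨S, hS, ?_⟩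
  rintro _ ⟨x, hx, y, hy, hxy, hc, rfl⟩ hA
  refine hS' {x, y} (by simp [Set.insert_subset_iff, hx, hy])
    ⟨_, ⟨x, by simp, y, by simp, hxy, hc, rfl⟩, ?_⟩
  simp [hA]

/-- The square-bracket filter, as an ultrafilter. -/
lemma exists_ultrafilter (h𝓕 : 𝓕.IsCapturing 2)
    (hm : ((Cardinal.aleph 1 : Cardinal.{0}) : WithTop Cardinal.{0}) < 𝓕.martinNumber 2) :
    ∃ U : Ultrafilter Omega1, (∀ A, A ∈ U ↔ A ∈ 𝓕.squareBracketFilter) ∧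
      ∀ A ∈ U, ¬ A.Countable := by
  have hunc : ∀ A ∈ 𝓕.squareBracketFilter, ¬ A.Countable := by
    rintro A ⟨S, hS, hSA⟩ hA
    exact not_countable_brackets h𝓕 hS (hA.mono hSA)
  have hinter : ∀ {A B}, A ∈ 𝓕.squareBracketFilter → B ∈ 𝓕.squareBracketFilter →
      A ∩ B ∈ 𝓕.squareBracketFilter := by
    rintro A B ⟨S, hS, hSA⟩ ⟨T, hT, hTB⟩
    obtain ⟨X, hX, hX'⟩ := exists_brackets_subset_inter (𝓕 := 𝓕) hS hT
    exact ⟨X, hX, hX'.trans (Set.inter_subset_inter hSA hTB)⟩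
  let V : Filter Omega1 :=
    { sets := 𝓕.squareBracketFilter
      univ_sets := ⟨Set.univ, not_countable_univ, Set.subset_univ _⟩
      sets_of_superset := fun ⟨S, hS, hSA⟩ hAB => ⟨S, hS, hSA.trans hAB⟩
      inter_sets := hinter }
  refine ⟨Ultrafilter.ofComplNotMemIff V fun A => ⟨fun hA => ?_, fun hA hA' => ?_⟩,
    fun A => Iff.rfl, hunc⟩
  · exact (mem_or_compl_mem_squareBracketFilter h𝓕 hm A).resolve_right hA
  · refine hunc _ (hinter hA hA') ?_
    rw [Set.inter_compl_self]
    exact Set.countable_empty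

end ConstructionScheme

/-- A uniform ultrafilter on `ω₁` is not countably complete. -/
lemma exists_surjective_forall_fiber_notMem (U : Ultrafilter Omega1)
    (hU : ∀ A ∈ U, ¬ A.Countable) :
    ∃ π : Omega1 → ℕ, Function.Surjective π ∧ ∀ k, π ⁻¹' {k} ∉ U := by
  classical
  obtain ⟨e⟩ : Nonempty (Omega1 ↪ (ℕ → Bool)) := by
    rw [← Cardinal.le_def]
    simpa using Cardinal.aleph_one_le_continuum
  have hb : ∀ n, ∃ b, {x | e x n = b} ∈ U := by
    intro n
    rcases U.mem_or_compl_mem {x | e x n = true} with h | h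
    · exact ⟨true, h⟩
    · refine ⟨false, Filter.mem_of_superset h fun x hx => ?_⟩
      simpa using hx
  choose b hb using hb
  let f : Omega1 → ℕ := fun x => sInf {n | e x n ≠ b n}
  -- `f x` is the first disagreement with the `U`-majority branch `b`. Agreement at that coordinate
  -- is possible only in the default case `e x = b`, hence for at most one `x`.
  have hf : ∀ k, f ⁻¹' {k} ∉ U := by
    intro k hk
    have h1 : f ⁻¹' {k} ∩ {x | e x k = b k} ∈ U := Filter.inter_mem hk (hb k)
    refine hU _ h1 (Set.Subsingleton.countable ?_)
    have h2 : ∀ x ∈ f ⁻¹' {k} ∩ {x | e x k = b k}, e x = b := by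
      rintro x ⟨hx, hx'⟩
      by_contra hne
      obtain ⟨n, hn⟩ := Function.ne_iff.1 hne
      have := Nat.sInf_mem (s := {n | e x n ≠ b n}) ⟨n, hn⟩
      rw [show sInf {n | e x n ≠ b n} = k from hx] at this
      exact this hx'
    exact fun x hx y hy => e.injective ((h2 x hx).trans (h2 y hy).symm)
  have hinf : (Set.range f).Infinite := by
    intro hfin
    have h1 : (⋃ k ∈ Set.range f, f ⁻¹' {k}) ∈ U := by
      rw [← Set.preimage_iUnion₂, Set.biUnion_of_singleton, Set.preimage_range]
      exact Filter.univ_mem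
    obtain ⟨k, -, hk⟩ := (Ultrafilter.finite_biUnion_mem_iff hfin).1 h1
    exact hf k hk
  have := hinf.to_subtype
  obtain ⟨g⟩ := nonempty_equiv_of_countable (α := Set.range f) (β := ℕ)
  refine ⟨fun x => g ⟨f x, x, rfl⟩, fun k => ?_, fun k hk => ?_⟩
  · obtain ⟨⟨_, x, rfl⟩, hx⟩ := g.surjective k
    exact ⟨x, hx⟩
  · refine hf (g.symm k) (Filter.mem_of_superset hk fun x hx => ?_)
    have hx : g ⟨f x, x, rfl⟩ = k := hx
    simp [← hx]

/-! ### Ramsey projections -/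

namespace ConstructionScheme

variable {τ : SchemeType} {𝓕 : ConstructionScheme τ}

lemma isRamsey_map (h𝓕 : 𝓕.IsCapturing 2)
    (hm : ((Cardinal.aleph 1 : Cardinal.{0}) : WithTop Cardinal.{0}) < 𝓕.martinNumber 2)
    {U : Ultrafilter Omega1} (hU : ∀ A, A ∈ U ↔ A ∈ 𝓕.squareBracketFilter) {π : Omega1 → ℕ}
    (hπ : ∀ k, π ⁻¹' {k} ∉ U) : IsRamsey (U.map π) := by
  refine ⟨hπ, fun 𝓟 h𝓟 _ hcompl => ?_⟩
  have hblock : ∀ n, ∃ B ∈ 𝓟, n ∈ B := fun n => (h𝓟.2 n).exists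
  choose c hc hnc using hblock
  have huniq : ∀ B ∈ 𝓟, ∀ n ∈ B, B = c n := fun B hB n hn =>
    (h𝓟.2 n).unique ⟨hB, hn⟩ ⟨hc n, hnc n⟩
  have hQ : 𝓕.Extendible π {q | ∀ B ∈ 𝓟, (q ∩ B).Subsingleton} := by
    refine ⟨by simp, fun q hq q' hq' B hB =>
      (hq B hB).anti (Set.inter_subset_inter_left _ hq'), fun q hq hfin S hS => ?_⟩
    -- A finite selector touches finitely many blocks; `U` avoids them all, so some bracket of `S`
    -- has a colour in a fresh block.
    have h1 : (⋂ n ∈ q, π ⁻¹' (c n)ᶜ) ∈ U :=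
      (Filter.biInter_mem hfin).2 fun n _ => hcompl (c n) (hc n)
    have h2 : 𝓕.brackets S ∈ U := (hU _).2 ⟨S, hS, subset_rfl⟩
    obtain ⟨z, hz, hz'⟩ := U.nonempty_of_mem (Filter.inter_mem h2 h1)
    have hz' : ∀ n ∈ q, π z ∉ c n := by simpa using hz'
    refine ⟨z, hz, fun B hB => ?_⟩
    rintro x ⟨rfl | hx, hxB⟩ y ⟨rfl | hy, hyB⟩
    · rfl
    · exact absurd hxB (huniq B hB y hyB ▸ hz' y hy)
    · exact absurd hyB (huniq B hB x hxB ▸ hz' x hx)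
    · exact hq B hB ⟨hx, hxB⟩ ⟨hy, hyB⟩
  obtain ⟨S, hS, hS'⟩ := hQ.exists_homogeneous h𝓕 hm
  refine ⟨π '' 𝓕.brackets S, ?_, fun B hB => ?_⟩
  · exact Ultrafilter.mem_map.2 ((hU _).2 ⟨S, hS, Set.subset_preimage_image _ _⟩)
  · rintro _ ⟨⟨_, ⟨x, hx, y, hy, hxy, hc, rfl⟩, rfl⟩, h1⟩ _
      ⟨⟨_, ⟨x', hx', y', hy', hxy', hc', rfl⟩, rfl⟩, h2⟩
    -- Two brackets involve only four points of `S`, so homogeneity for finite subsets suffices.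
    refine hS' {x, y, x', y'} (by simp [Set.insert_subset_iff, hx, hy, hx', hy']) B hB
      ⟨⟨_, ⟨x, by simp, y, by simp, hxy, hc, rfl⟩, rfl⟩, h1⟩
      ⟨⟨_, ⟨x', by simp, y', by simp, hxy', hc', rfl⟩, rfl⟩, h2⟩

end ConstructionScheme

end ConstructionSchemes

theorem mainTheorem10 (τ : ConstructionSchemes.SchemeType) (hτ : τ.Good)
    (𝓕 : ConstructionSchemes.ConstructionScheme τ) (h𝓕 : 𝓕.IsCapturing 2)
    (hm : ((Cardinal.aleph 1 : Cardinal.{0}) : WithTop Cardinal.{0}) < 𝓕.martinNumber 2) :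
    (∃ U : Ultrafilter ConstructionSchemes.Omega1,
      (∀ A, A ∈ U ↔ A ∈ 𝓕.squareBracketFilter) ∧ ∀ A ∈ U, ¬ A.Countable) ∧
    (∃ π : ConstructionSchemes.Omega1 → ℕ, Function.Surjective π ∧
      ∀ k, π ⁻¹' {k} ∉ 𝓕.squareBracketFilter) ∧
    ∀ π : ConstructionSchemes.Omega1 → ℕ, (∀ k, π ⁻¹' {k} ∉ 𝓕.squareBracketFilter) →
      ∃ W : Ultrafilter ℕ,
        (∀ A, A ∈ W ↔ A ∈ ConstructionSchemes.projection π 𝓕.squareBracketFilter) ∧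
        ConstructionSchemes.IsRamsey W := by
  obtain ⟨U, hU, hunc⟩ := ConstructionSchemes.ConstructionScheme.exists_ultrafilter h𝓕 hm
  obtain ⟨π, hπ, hπ'⟩ := ConstructionSchemes.exists_surjective_forall_fiber_notMem U hunc
  refine ⟨⟨U, hU, hunc⟩, ⟨π, hπ, fun k hk => hπ' k ((hU _).2 hk)⟩, fun π hπ => ?_⟩
  exact ⟨U.map π, fun A => hU _, ConstructionSchemes.ConstructionScheme.isRamsey_map h𝓕 hm hU
    fun k hk => hπ k ((hU _).1 hk)⟩
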